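/- **Setting.** Let $L$ be a finite function-free first-order vocabulary of predicates of arbitrary arities, with or without equality. A *weighting* $(w,\bar w)$ assigns to every predicate $P$ of $L$ two real weights $w(P),\bar w(P)\ge 0$. The weight $W(\mu)$ of an $L$-structure $\mu$ over the domain $[n]$ of $n$ elements is the product, over all ground atoms $P(a_1,\dots,a_k)$ with $a_i\in[n]$, of $w(P)$ if the atom is true in $\mu$ and of $\bar w(P)$ if it is false. For a sentence $\Gamma$ put $\mathrm{WFOMC}(\Gamma,n,w,\bar w)=\sum_{\mu}W(\mu)$, the sum ranging over all models $\mu$ of $\Gamma$ with domain $[n]$. Algorithms are programs for a randomized random access machine with natural-number and real registers (direct and indirect addressing) that performs, each in one step, an addition or (truncated) subtraction of natural numbers, an arithmetic operation ($+,-,\times,/$) or comparison of real numbers, reading a weight $w(P)$ or $\bar w(P)$, one independent toss of a coin whose bias is the content of a real register, or the output of one ground literal. The only inputs are $n$ and the weights. A sentence $\Gamma$ is *domain-liftable under sampling* if there are a program and a polynomial $T$ such that, for every weighting $(w,\bar w)$ and every $n\in\mathbb N$, the program halts within $T(n)$ steps whatever the outcomes of its coin tosses, and, if $\mathrm{WFOMC}(\Gamma,n,w,\bar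 w)\neq 0$, it outputs each model $\mu$ of $\Gamma$ over $[n]$ with probability exactly $$\mathbb P[\mu]=\frac{W(\mu)}{\mathrm{WFOMC}(\Gamma,n,w,\bar w)}$$ (and outputs nothing else). **Theorem.** The fragment $\mathbf{UFO}^2$ is domain-liftable under sampling: every sentence of the form $\forall x\,\forall y\;\psi(x,y)$, with $\psi$ a quantifier-free formula over $L$, is domain-liftable under sampling. -/

import Mathlib

open scoped NNReal ENNReal

universe u v

noncomputable section

namespace WFOMS

/-! ### Structures, weights and weighted first-order model counting -/

/-- The predicates (of any arity) of a vocabulary. -/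
abbrev Predicate (L : FirstOrder.Language.{u, v}) : Type v := Σ k : ℕ, L.Relations k

/-- Ground atoms `P(a₁, …, aₖ)` over the domain `M`. -/
abbrev GroundAtom (L : FirstOrder.Language.{u, v}) (M : Type) : Type v :=
  Σ P : Predicate L, (Fin P.1 → M)

/-- A structure with domain `M` for a function-free vocabulary, presented by the truth values of
its ground atoms. -/
abbrev World (L : FirstOrder.Language.{u, v}) (M : Type) : Type v := GroundAtom L M → Bool

instance World.instFintype (L : FirstOrder.Language.{u, v}) [Fintype (Predicate L)] (n : ℕ) :
    Fintype (World L (Fin n)) := by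
  classical
  exact inferInstance

/-- The first-order structure described by a world. -/
@[reducible] def World.toStructure {L : FirstOrder.Language.{u, v}} [L.IsRelational] {M : Type}
    (μ : World L M) : L.Structure M where
  funMap := fun f _ => isEmptyElim f
  RelMap := fun {k} R a => μ ⟨⟨k, R⟩, a⟩ = true

/-- `μ` is a model of the sentence `Γ` (standard semantics of first-order logic). -/
def World.Models {L : FirstOrder.Language.{u, v}} [L.IsRelational] {M : Type}
    (μ : World L M) (Γ : L.Sentence) : Prop :=
  @FirstOrder.Language.Sentence.Realize L M μ.toStructure Γ

/-- A pair `(w, w̄)` of non-negative weighting functions: `pos P` is the weight of every true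
ground literal of `P`, and `neg P` is the weight of every false one. -/
structure Weighting (L : FirstOrder.Language.{u, v}) where
  pos : Predicate L → ℝ≥0
  neg : Predicate L → ℝ≥0

variable {L : FirstOrder.Language.{u, v}}

/-- The weight of a structure over `{0, …, n-1}`: the product of the weights of its ground
literals. -/
def Weighting.weight [Fintype (Predicate L)] (W : Weighting L) {n : ℕ}
    (μ : World L (Fin n)) : ℝ≥0 :=
  ∏ a : GroundAtom L (Fin n), if μ a = true then W.pos a.1 else W.neg a.1

open Classical in
/-- Weighted first-order model count: the sum of the weights of the models of `Γ` over a domain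
of size `n`. -/
def WFOMC [L.IsRelational] [Fintype (Predicate L)] (Γ : L.Sentence) (n : ℕ)
    (W : Weighting L) : ℝ≥0 :=
  ∑ μ : World L (Fin n), if μ.Models Γ then W.weight μ else 0

/-! ### The machine model

A randomized real random access machine, programmed by structured (while) programs. It has an
array `N` of natural numbers and an array `R` of real numbers, both with direct and indirect
addressing, access to the weights of the predicates, a biased coin, and a memory of ground
atoms, which holds its output. -/

/-- Memory of the machine. -/
structure State (L : FirstOrder.Language.{u, v}) where
  /-- the natural-number memory -/
  N : ℕ → ℕ
  /-- the real-number memory -/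
  R : ℕ → ℝ
  /-- the output: truth values of ground atoms; element `e_i` of the domain is written `i` -/
  out : World L ℕ

/-- Elementary instructions. -/
inductive Instr (L : FirstOrder.Language.{u, v}) : Type v
  /-- `N[a] := k` -/
  | const (a k : ℕ)
  /-- `N[a] := N[b] + N[c]` -/
  | add (a b c : ℕ)
  /-- `N[a] := N[b] - N[c]` (zero if the difference is negative) -/
  | sub (a b c : ℕ)
  /-- `N[a] := N[N[b]]` -/
  | load (a b : ℕ)
  /-- `N[N[a]] := N[b]` -/
  | store (a b : ℕ)
  /-- `R[a] := w(P)` -/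
  | weightPos (a : ℕ) (P : Predicate L)
  /-- `R[a] := w̄(P)` -/
  | weightNeg (a : ℕ) (P : Predicate L)
  /-- `R[a] := N[b]` -/
  | rcast (a b : ℕ)
  /-- `R[a] := R[b] + R[c]` -/
  | radd (a b c : ℕ)
  /-- `R[a] := R[b] - R[c]` -/
  | rsub (a b c : ℕ)
  /-- `R[a] := R[b] * R[c]` -/
  | rmul (a b c : ℕ)
  /-- `R[a] := R[b] / R[c]` (zero if `R[c] = 0`) -/
  | rdiv (a b c : ℕ)
  /-- `R[a] := R[N[b]]` -/
  | rload (a b : ℕ)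
  /-- `R[N[a]] := R[b]` -/
  | rstore (a b : ℕ)
  /-- `N[a] := 1` with probability `R[b]` and `N[a] := 0` otherwise (with `R[b]` clamped to
  `[0, 1]`), independently of all other coins -/
  | flip (a b : ℕ)
  /-- output the ground literal of `P` with arguments `N[args 0], N[args 1], …`: positive if
  `N[c] ≠ 0` and negative otherwise -/
  | put (P : Predicate L) (args : Fin P.1 → ℕ) (c : ℕ)

/-- Tests that control branching. -/
inductive Test
  /-- `N[a] < N[b]` -/
  | natLt (a b : ℕ)
  /-- `R[a] < R[b]` -/
  | realLt (a b : ℕ)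

/-- Programs. -/
inductive Prog (L : FirstOrder.Language.{u, v}) : Type v
  | instr (i : Instr L)
  | seq (p q : Prog L)
  /-- if `t` holds then `p` else `q` -/
  | ite (t : Test) (p q : Prog L)
  /-- while `t` holds do `p` -/
  | loop (t : Test) (p : Prog L)

/-- The distribution of one toss of a coin that shows `1` with probability `x` (clamped to
`[0, 1]`) and `0` otherwise. -/
def coin (x : ℝ) : PMF Bool :=
  PMF.ofFintype
    (fun b => if b = true then ((min x.toNNReal 1 : ℝ≥0) : ℝ≥0∞)
      else ((1 - min x.toNNReal 1 : ℝ≥0) : ℝ≥0∞))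
    (by
      rw [Fintype.sum_bool]
      simp only [if_true, Bool.false_eq_true, if_false]
      rw [← ENNReal.coe_add, add_tsub_cancel_of_le (min_le_right _ _), ENNReal.coe_one])

def State.setN (s : State L) (a k : ℕ) : State L := { s with N := Function.update s.N a k }

def State.setR (s : State L) (a : ℕ) (x : ℝ) : State L := { s with R := Function.update s.R a x }

open Classical in
def State.setOut (s : State L) (a : GroundAtom L ℕ) (b : Bool) : State L :=
  { s with out := Function.update s.out a b }

/-- Execution of an elementary instruction. -/
def Instr.exec (W : Weighting L) : Instr L → State L → PMF (State L)
  | .const a k, s => PMF.pure (s.setN a k)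
  | .add a b c, s => PMF.pure (s.setN a (s.N b + s.N c))
  | .sub a b c, s => PMF.pure (s.setN a (s.N b - s.N c))
  | .load a b, s => PMF.pure (s.setN a (s.N (s.N b)))
  | .store a b, s => PMF.pure (s.setN (s.N a) (s.N b))
  | .weightPos a P, s => PMF.pure (s.setR a (W.pos P : ℝ))
  | .weightNeg a P, s => PMF.pure (s.setR a (W.neg P : ℝ))
  | .rcast a b, s => PMF.pure (s.setR a (s.N b : ℝ))
  | .radd a b c, s => PMF.pure (s.setR a (s.R b + s.R c))
  | .rsub a b c, s => PMF.pure (s.setR a (s.R b - s.R c))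
  | .rmul a b c, s => PMF.pure (s.setR a (s.R b * s.R c))
  | .rdiv a b c, s => PMF.pure (s.setR a (s.R b / s.R c))
  | .rload a b, s => PMF.pure (s.setR a (s.R (s.N b)))
  | .rstore a b, s => PMF.pure (s.setR (s.N a) (s.R b))
  | .flip a b, s => (coin (s.R b)).map (fun r => s.setN a (if r = true then 1 else 0))
  | .put P args c, s =>
      PMF.pure (s.setOut ⟨P, fun i => s.N (args i)⟩ (decide (s.N c ≠ 0)))

open Classical in
def Test.eval : Test → State L → Bool
  | .natLt a b, s => decide (s.N a < s.N b)
  | .realLt a b, s => decide (s.R a < s.R b)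

/-- A configuration: the list of programs that remain to be executed, and the memory. -/
structure Config (L : FirstOrder.Language.{u, v}) where
  todo : List (Prog L)
  state : State L

/-- One computation step. A configuration with nothing left to execute has halted. -/
def step (W : Weighting L) : Config L → PMF (Config L)
  | ⟨[], s⟩ => PMF.pure ⟨[], s⟩
  | ⟨.instr i :: K, s⟩ => (i.exec W s).map (fun s' => ⟨K, s'⟩)
  | ⟨.seq p q :: K, s⟩ => PMF.pure ⟨p :: q :: K, s⟩
  | ⟨.ite t p q :: K, s⟩ => PMF.pure ⟨(if t.eval s = true then p else q) :: K, s⟩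
  | ⟨.loop t p :: K, s⟩ =>
      PMF.pure (if t.eval s = true then ⟨p :: .loop t p :: K, s⟩ else ⟨K, s⟩)

/-- The distribution of the configuration after a given number of steps. -/
def run (W : Weighting L) : ℕ → Config L → PMF (Config L)
  | 0, c => PMF.pure c
  | t + 1, c => (step W c).bind (run W t)

/-- On input `n` the machine starts with `N[0] = n`, all other memory cells zero, and all
ground atoms false. -/
def start (p : Prog L) (n : ℕ) : Config L :=
  ⟨[p], ⟨fun i => if i = 0 then n else 0, fun _ => 0, fun _ => false⟩⟩

/-- The structure over the domain `{0, …, n-1}` that is stored in the output memory. -/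
def Config.output (n : ℕ) (c : Config L) : World L (Fin n) :=
  fun a => c.state.out ⟨a.1, fun i => (a.2 i : ℕ)⟩

/-! ### Weighted model samplers and liftability under sampling -/

/-- On every weighting `W` and every domain size `n`, the program `p` halts after at most `T n`
steps, whatever the outcomes of its coins. -/
def HaltsWithin (p : Prog L) (T : ℕ → ℕ) : Prop :=
  ∀ (W : Weighting L) (n : ℕ), ∀ c ∈ (run W (T n) (start p n)).support, c.todo = []

open Classical in
/-- The output of `p`, if it is stopped after `T n` steps, solves the weighted first-order model
sampling problem of `Γ`: whenever this problem is defined, that is, `WFOMC Γ n W ≠ 0`, every model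
`μ` of `Γ` is generated with probability `weight μ / WFOMC`, and nothing else is generated. -/
def Samples [L.IsRelational] [Fintype (Predicate L)] (p : Prog L) (T : ℕ → ℕ)
    (Γ : L.Sentence) : Prop :=
  ∀ (W : Weighting L) (n : ℕ), WFOMC Γ n W ≠ 0 → ∀ μ : World L (Fin n),
    ((run W (T n) (start p n)).map (Config.output n)) μ =
      if μ.Models Γ then ((W.weight μ / WFOMC Γ n W : ℝ≥0) : ℝ≥0∞) else 0

/-- A sentence is domain-liftable under sampling if it has a weighted model sampler that runs in
time polynomial in the domain size. -/
def SamplingLiftable [L.IsRelational] [Fintype (Predicate L)] (Γ : L.Sentence) : Prop :=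
  ∃ (p : Prog L) (T : Polynomial ℕ),
    HaltsWithin p (fun n => T.eval n) ∧ Samples p (fun n => T.eval n) Γ

/-- The fragment of sentences `∀ x ∀ y, ψ(x, y)` with `ψ` quantifier-free. -/
def UFO2 (L : FirstOrder.Language.{u, v}) : Set L.Sentence :=
  {Γ | ∃ ψ : L.BoundedFormula Empty 2, ψ.IsQF ∧ Γ = ψ.all.all}

end WFOMS

end

/-! A sentence `∀ x ∀ y, ψ` with `ψ` quantifier-free holds in a structure iff it holds in every
substructure with one or two elements (`World.models_pull_iff`). So the weight of a model factors
into a factor for every element (its cell, the 1-type), a factor for every pair (the mixed atoms of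
the 2-type), and the literals with at least three distinct elements, which `Γ` does not constrain.
Nullary atoms are charged to the element `0`; they are unconstrained only if `n = 0`.

The unconstrained atoms are independent coins. For the rest, elements are added one at a time. Once
the cells of the earlier elements are fixed, the weight of all ways to add the others depends only
on the vector `κ` that counts how often each cell has occurred: this is `completion`. The number of
cells is a constant of the vocabulary, so there are polynomially many vectors, and `completion` can
be tabulated by dynamic programming. A new element gets the cell `j` with probability proportional
to its own weight, times the product of the total weights `linkWeight` of the pairs with earlier
elements, times the table entry for the enlarged vector. Then its pair with each earlier element is
drawn with probability proportional to `pairWeight`. The normalizing constants cancel: those of the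
pairs against `linkWeight`, that of the next element against the table entry. What remains is the
weight of the model divided by one constant.

The analysis computes, for a fixed target world `m`, the expectation of the indicator that the
output is `m`, going backwards through the program. Every step has the form (normalizing constant) *
(expectation) = (indicator that the output so far agrees with `m`) * (weight still to be
contributed). In this form nothing is divided, so vanishing weights need no separate treatment. The
carrying lemmas are `forList_flipAtom`, `exists_tableCmd_eq`, `pairCmd_loop`, `branchCmd_spec` and
`elemCmd_loop`. The constant need not be identified by hand: the output probabilities sum to one, so
it equals `WFOMC` (`IsCmd.samplingLiftable`).

On the machine side, `Sim` relates a program to an expectation transformer, for an arbitrary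
continuation and every sufficiently large number of steps. It therefore composes, tolerates branches
of different lengths, and yields the time bound along with the output distribution. -/

noncomputable section

namespace WFOMS

/-! ### Deterministic computations and polynomial-time expressions -/

section Machine

variable {L : FirstOrder.Language.{u, v}}

/-! ### Deterministic executions -/

/-- From `σ` the program `p` reaches `σ'` within `T` steps without tossing coins. -/
def Runs (W : Weighting L) (p : Prog L) (σ : State L) (T : ℕ) (σ' : State L) : Prop :=
  ∃ τ ≤ T, ∀ K t, run W (t + τ) ⟨p :: K, σ⟩ = run W t ⟨K, σ'⟩

namespace Runs

variable {W : Weighting L} {p q : Prog L} {σ σ' σ'' : State L} {T T' : ℕ}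

theorem mono (h : Runs W p σ T σ') (hT : T ≤ T') : Runs W p σ T' σ' := by
  obtain ⟨τ, hτ, h⟩ := h
  exact ⟨τ, hτ.trans hT, h⟩

theorem instr {i : Instr L} (h : i.exec W σ = PMF.pure σ') : Runs W (.instr i) σ 1 σ' := by
  refine ⟨1, le_rfl, fun K t => ?_⟩
  rw [run, step, h, PMF.pure_map, PMF.pure_bind]

theorem seq (h : Runs W p σ T σ') (h' : Runs W q σ' T' σ'') :
    Runs W (.seq p q) σ (T + T' + 1) σ'' := by
  obtain ⟨τ, hτ, h⟩ := h
  obtain ⟨τ', hτ', h'⟩ := h'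
  refine ⟨τ' + τ + 1, by omega, fun K t => ?_⟩
  rw [← add_assoc, ← add_assoc, run, step, PMF.pure_bind, h, h']

theorem ite {t : Test} (h : Runs W (if t.eval σ = true then p else q) σ T σ') :
    Runs W (.ite t p q) σ (T + 1) σ' := by
  obtain ⟨τ, hτ, h⟩ := h
  refine ⟨τ + 1, by omega, fun K t => ?_⟩
  rw [← add_assoc, run, step, PMF.pure_bind, h]

/-- Invariant rule for a loop with exactly `M` rounds, where `I i` describes the state after `i`
rounds. The induction is on the number of rounds that remain; each costs one test besides the body.
-/
theorem loop {t : Test} (I : ℕ → State L → Prop) (M : ℕ)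
    (hbody : ∀ i < M, ∀ σ, I i σ → t.eval σ = true ∧ ∃ σ', Runs W p σ T σ' ∧ I (i + 1) σ')
    (hexit : ∀ σ, I M σ → t.eval σ = false) (h0 : I 0 σ) :
    ∃ σ', Runs W (.loop t p) σ (M * (T + 1) + 1) σ' ∧ I M σ' := by
  have key : ∀ k ≤ M, ∀ σ, I (M - k) σ →
      ∃ σ', Runs W (.loop t p) σ (k * (T + 1) + 1) σ' ∧ I M σ' := by
    intro k
    induction k with
    | zero =>
      intro _ σ h
      refine ⟨σ, ⟨1, by omega, fun K s => ?_⟩, h⟩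
      rw [run, step, PMF.pure_bind, if_neg (by simp [hexit σ h])]
    | succ k ih =>
      intro hk σ h
      obtain ⟨ht, σ₁, ⟨τ, hτ, hr⟩, h₁⟩ := hbody (M - (k + 1)) (by omega) σ h
      rw [show M - (k + 1) + 1 = M - k by omega] at h₁
      obtain ⟨σ₂, ⟨τ', hτ', hr'⟩, h₂⟩ := ih (by omega) σ₁ h₁
      refine ⟨σ₂, ⟨τ' + τ + 1, ?_, fun K s => ?_⟩, h₂⟩
      · rw [add_mul]; omega
      · rw [← add_assoc, ← add_assoc, run, step, PMF.pure_bind, if_pos ht, hr, hr']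
  exact key M le_rfl σ (by simpa using h0)

end Runs

/-! ### Expectations -/

/-- The expectation of `Φ` under `D`. -/
def expect {α : Type*} (D : PMF α) (Φ : α → ℝ≥0∞) : ℝ≥0∞ := ∑' a, D a * Φ a

theorem expect_pure {α : Type*} (a : α) (Φ : α → ℝ≥0∞) : expect (PMF.pure a) Φ = Φ a := by
  classical
  rw [expect, tsum_eq_single a]
  · simp
  · intro b hb
    simp [PMF.pure_apply, hb]

theorem expect_bind {α β : Type*} (D : PMF α) (F : α → PMF β) (Φ : β → ℝ≥0∞) :
    expect (D.bind F) Φ = expect D (fun a => expect (F a) Φ) := by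
  simp only [expect, PMF.bind_apply, ← ENNReal.tsum_mul_right, ← ENNReal.tsum_mul_left, mul_assoc]
  exact ENNReal.tsum_comm

theorem expect_map {α β : Type*} (D : PMF α) (F : α → β) (Φ : β → ℝ≥0∞) :
    expect (D.map F) Φ = expect D (fun a => Φ (F a)) := by
  rw [PMF.map, expect_bind]
  simp only [Function.comp_apply, expect_pure]

theorem expect_coin (x : ℝ≥0) (Φ : Bool → ℝ≥0∞) :
    expect (coin x) Φ
      = ((min x 1 : ℝ≥0) : ℝ≥0∞) * Φ true + ((1 - min x 1 : ℝ≥0) : ℝ≥0∞) * Φ false := by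
  rw [expect, tsum_bool, add_comm]
  simp [coin]

/-! ### The memory seen by a sampler, and its representation in the machine -/

/-- Unary types: the worlds with one element. They include the nullary atoms. -/
abbrev Cell (L : FirstOrder.Language.{u, v}) : Type v := World L (Fin 1)

/-- The abstract memory of a sampler: a counter for every cell, a table of weights, a list of
cells, and the output. -/
structure Mem (L : FirstOrder.Language.{u, v}) where
  count : Cell L → ℕ
  tab : ℕ → ℝ≥0
  cell : ℕ → Cell L
  out : World L ℕ

/-- The parameters of a run and the values of the loop variables. -/
structure Env (L : FirstOrder.Language.{u, v}) where
  W : Weighting L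
  n : ℕ
  var : ℕ → ℕ

/-- Give the value `t` to the loop variable of depth `d`. -/
def Env.push (E : Env L) (d t : ℕ) : Env L := { E with var := Function.update E.var d t }

@[simp] theorem Env.push_W (E : Env L) (d t : ℕ) : (E.push d t).W = E.W := rfl

@[simp] theorem Env.push_n (E : Env L) (d t : ℕ) : (E.push d t).n = E.n := rfl

@[simp] theorem Env.push_var_self (E : Env L) (d t : ℕ) : (E.push d t).var d = t := by
  simp [Env.push]

theorem Env.push_var_of_ne (E : Env L) {d e : ℕ} (t : ℕ) (h : e ≠ d) :
    (E.push d t).var e = E.var e := by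
  simp [Env.push, h]

theorem card_cell_pos [Fintype (Predicate L)] : 0 < Fintype.card (Cell L) :=
  Fintype.card_pos_iff.2 ⟨fun _ => false⟩

/-- A numbering of the cells. -/
def enc [Fintype (Predicate L)] : Cell L ≃ Fin (Fintype.card (Cell L)) := Fintype.equivFin _

/-- The machine state `σ` represents the memory `s`, and the loop variables of depth less
than `d`. -/
structure Rel [Fintype (Predicate L)] (d : ℕ) (E : Env L) (s : Mem L) (σ : State L) : Prop where
  dom : σ.N 0 = E.n
  count : ∀ c, σ.N (3 * (enc c : ℕ) + 1) = s.count c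
  var : ∀ e < d, σ.N (3 * e + 2) = E.var e
  tab : ∀ i, σ.R (3 * i) = s.tab i
  cell : ∀ i, σ.R (3 * i + 1) = ((enc (s.cell i) : ℕ) : ℝ)
  out : σ.out = s.out

/-- The states agree except on the temporary registers from the `j`-th on. -/
structure Same (j : ℕ) (σ σ' : State L) : Prop where
  N : ∀ r, (∀ i ≥ j, r ≠ 3 * i + 3) → σ'.N r = σ.N r
  R : ∀ r, (∀ i ≥ j, r ≠ 3 * i + 2) → σ'.R r = σ.R r
  out : σ'.out = σ.out

namespace Same

variable {j j' : ℕ} {σ σ' σ'' : State L}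

theorem refl (j : ℕ) (σ : State L) : Same j σ σ := ⟨fun _ _ => rfl, fun _ _ => rfl, rfl⟩

theorem trans (h : Same j σ σ') (h' : Same j σ' σ'') : Same j σ σ'' :=
  ⟨fun r hr => (h'.N r hr).trans (h.N r hr), fun r hr => (h'.R r hr).trans (h.R r hr),
    h'.out.trans h.out⟩

theorem mono (h : Same j' σ σ') (hj : j ≤ j') : Same j σ σ' :=
  ⟨fun r hr => h.N r fun i hi => hr i (hj.trans hi),
    fun r hr => h.R r fun i hi => hr i (hj.trans hi), h.out⟩

theorem setN (h : Same j σ σ') {i : ℕ} (hi : j ≤ i) (k : ℕ) : Same j σ (σ'.setN (3 * i + 3) k) :=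
  ⟨fun r hr => by simpa [State.setN, Function.update_apply, hr i hi] using h.N r hr, h.R, h.out⟩

theorem setR (h : Same j σ σ') {i : ℕ} (hi : j ≤ i) (x : ℝ) : Same j σ (σ'.setR (3 * i + 2) x) :=
  ⟨h.N, fun r hr => by simpa [State.setR, Function.update_apply, hr i hi] using h.R r hr, h.out⟩

theorem tempN (h : Same j σ σ') {i : ℕ} (hi : i < j) : σ'.N (3 * i + 3) = σ.N (3 * i + 3) :=
  h.N _ fun k hk => by omega

theorem tempR (h : Same j σ σ') {i : ℕ} (hi : i < j) : σ'.R (3 * i + 2) = σ.R (3 * i + 2) :=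
  h.R _ fun k hk => by omega

end Same

@[simp] theorem State.setN_N (σ : State L) (a k r : ℕ) :
    (σ.setN a k).N r = if r = a then k else σ.N r := by
  simp [State.setN, Function.update_apply]

@[simp] theorem State.setN_R (σ : State L) (a k : ℕ) : (σ.setN a k).R = σ.R := rfl

@[simp] theorem State.setN_out (σ : State L) (a k : ℕ) : (σ.setN a k).out = σ.out := rfl

@[simp] theorem State.setR_R (σ : State L) (a : ℕ) (x : ℝ) (r : ℕ) :
    (σ.setR a x).R r = if r = a then x else σ.R r := by
  simp [State.setR, Function.update_apply]

@[simp] theorem State.setR_N (σ : State L) (a : ℕ) (x : ℝ) : (σ.setR a x).N = σ.N := rfl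

@[simp] theorem State.setR_out (σ : State L) (a : ℕ) (x : ℝ) : (σ.setR a x).out = σ.out := rfl

variable [Fintype (Predicate L)]

/-- Memory is laid out by residues modulo 3. Natural registers: `0` holds `n`, `3i+1` the counters,
`3i+2` the loop variables, `3i+3` temporaries. Real registers: `3i` the table, `3i+1` the codes of
cells, `3i+2` temporaries. Writing to temporaries thus cannot disturb what is represented. -/
theorem Rel.same {d j : ℕ} {E : Env L} {s : Mem L} {σ σ' : State L} (h : Rel d E s σ)
    (h' : Same j σ σ') : Rel d E s σ' where
  dom := (h'.N _ fun i _ => by omega).trans h.dom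
  count c := (h'.N _ fun i _ => by omega).trans (h.count c)
  var e he := (h'.N _ fun i _ => by omega).trans (h.var e he)
  tab i := (h'.R _ fun i _ => by omega).trans (h.tab i)
  cell i := (h'.R _ fun i _ => by omega).trans (h.cell i)
  out := h'.out.trans h.out

/-! ### Expressions that the machine can evaluate -/

/-- The natural number `e` can be computed into any temporary register, in polynomial time. -/
def IsNat (d : ℕ) (e : Env L → Mem L → ℕ) : Prop :=
  ∀ j, ∃ (p : Prog L) (T : Polynomial ℕ), ∀ E s σ, Rel d E s σ →
    ∃ σ', Runs E.W p σ (T.eval E.n) σ' ∧ Same j σ σ' ∧ σ'.N (3 * j + 3) = e E s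

/-- The real number `e` can be computed into any temporary register, in polynomial time. -/
def IsReal (d : ℕ) (e : Env L → Mem L → ℝ≥0) : Prop :=
  ∀ j, ∃ (p : Prog L) (T : Polynomial ℕ), ∀ E s σ, Rel d E s σ →
    ∃ σ', Runs E.W p σ (T.eval E.n) σ' ∧ Same j σ σ' ∧ σ'.R (3 * j + 2) = e E s

namespace IsNat

variable {d : ℕ} {e e₁ e₂ : Env L → Mem L → ℕ}

theorem const (d k : ℕ) : IsNat (L := L) d (fun _ _ => k) := fun j =>
  ⟨.instr (.const (3 * j + 3) k), .C 1, fun E s σ _ =>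
    ⟨_, (Runs.instr rfl).mono (by simp), (Same.refl j σ).setN le_rfl k, by simp⟩⟩

/-- There is no move instruction, so a register is copied by adding it to a zeroed one; `hr` keeps
the source from being zeroed first. -/
theorem reg (r : ℕ) (hr : ∀ i, r ≠ 3 * i + 3) (h : ∀ E s σ, Rel d E s σ → σ.N r = e E s) :
    IsNat d e := fun j =>
  ⟨.seq (.instr (.const (3 * j + 3) 0)) (.instr (.add (3 * j + 3) r (3 * j + 3))), .C 3,
    fun E s σ hs => ⟨_, ((Runs.instr rfl).seq (Runs.instr rfl)).mono (by simp),
      ((Same.refl j σ).setN le_rfl _).setN le_rfl _, by simp [hr j, h E s σ hs]⟩⟩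

theorem dom (d : ℕ) : IsNat (L := L) d (fun E _ => E.n) :=
  reg 0 (fun i => by omega) fun _ _ _ h => h.dom

theorem count (d : ℕ) (c : Cell L) : IsNat d (fun _ s => s.count c) :=
  reg (3 * (enc c : ℕ) + 1) (fun i => by omega) fun _ _ _ h => h.count c

theorem var {d i : ℕ} (hi : i < d) : IsNat (L := L) d (fun E _ => E.var i) :=
  reg (3 * i + 2) (fun i => by omega) fun _ _ _ h => h.var i hi

/-- Temporaries form a stack: the second operand is computed at level `j + 1`, which leaves the
first one, stored at level `j`, intact. -/
theorem binop (I : ℕ → ℕ → ℕ → Instr L) (f : ℕ → ℕ → ℕ)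
    (hI : ∀ W a b c σ, (I a b c).exec W σ = PMF.pure (σ.setN a (f (σ.N b) (σ.N c))))
    (h₁ : IsNat d e₁) (h₂ : IsNat d e₂) : IsNat d (fun E s => f (e₁ E s) (e₂ E s)) := by
  intro j
  obtain ⟨p₁, T₁, h₁⟩ := h₁ j
  obtain ⟨p₂, T₂, h₂⟩ := h₂ (j + 1)
  refine ⟨.seq (.seq p₁ p₂) (.instr (I (3 * j + 3) (3 * j + 3) (3 * (j + 1) + 3))),
    T₁ + T₂ + .C 3, fun E s σ hs => ?_⟩
  obtain ⟨σ₁, r₁, s₁, v₁⟩ := h₁ E s σ hs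
  obtain ⟨σ₂, r₂, s₂, v₂⟩ := h₂ E s σ₁ (hs.same s₁)
  refine ⟨_, ((r₁.seq r₂).seq (Runs.instr (hI _ _ _ _ _))).mono ?_,
    (s₁.trans (s₂.mono (by omega))).setN le_rfl _, ?_⟩
  · simp; omega
  · simp [v₂, s₂.tempN, v₁]

theorem add (h₁ : IsNat d e₁) (h₂ : IsNat d e₂) : IsNat d (fun E s => e₁ E s + e₂ E s) :=
  binop .add _ (fun _ _ _ _ _ => rfl) h₁ h₂

theorem sub (h₁ : IsNat d e₁) (h₂ : IsNat d e₂) : IsNat d (fun E s => e₁ E s - e₂ E s) :=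
  binop .sub _ (fun _ _ _ _ _ => rfl) h₁ h₂

/-- The machine cannot multiply natural numbers in one step. Repeated addition with `n` rounds
suffices, since table addresses are numerals in base `n`. The temporaries from `j` on hold the
accumulator, the summand, the round counter and the constant 1. -/
theorem mul_dom (h : IsNat d e) : IsNat d (fun E s => e E s * E.n) := by
  intro j
  obtain ⟨p, T, h⟩ := h (j + 1)
  refine ⟨.seq (.seq p (.seq (.instr (.const (3 * j + 3) 0))
      (.seq (.instr (.const (3 * (j + 2) + 3) 0)) (.instr (.const (3 * (j + 3) + 3) 1)))))
    (.loop (.natLt (3 * (j + 2) + 3) 0)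
      (.seq (.instr (.add (3 * j + 3) (3 * j + 3) (3 * (j + 1) + 3)))
        (.instr (.add (3 * (j + 2) + 3) (3 * (j + 2) + 3) (3 * (j + 3) + 3))))),
    T + .C 4 * .X + .C 8, fun E s σ hs => ?_⟩
  obtain ⟨σ₁, r₁, s₁, v₁⟩ := h E s σ hs
  have r₂ := r₁.seq ((Runs.instr (W := E.W) (i := .const (3 * j + 3) 0) rfl).seq
    ((Runs.instr (i := .const (3 * (j + 2) + 3) 0) rfl).seq
      (Runs.instr (i := .const (3 * (j + 3) + 3) 1) rfl)))
  obtain ⟨σ', r₃, s₃, v₃, -⟩ := Runs.loop (W := E.W) (t := .natLt (3 * (j + 2) + 3) 0)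
    (p := .seq (.instr (.add (3 * j + 3) (3 * j + 3) (3 * (j + 1) + 3)))
        (.instr (.add (3 * (j + 2) + 3) (3 * (j + 2) + 3) (3 * (j + 3) + 3)))) (T := 3)
    (σ := ((σ₁.setN (3 * j + 3) 0).setN (3 * (j + 2) + 3) 0).setN (3 * (j + 3) + 3) 1)
    (fun i σ' => Same j σ σ' ∧ σ'.N (3 * j + 3) = e E s * i ∧ σ'.N (3 * (j + 1) + 3) = e E s ∧
      σ'.N (3 * (j + 2) + 3) = i ∧ σ'.N (3 * (j + 3) + 3) = 1) E.n
    (by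
      rintro i hi σ' ⟨hs', h0, h1, h2, h3⟩
      refine ⟨by simp [Test.eval, (hs.same hs').dom, h2, hi], _,
        (Runs.instr rfl).seq (Runs.instr rfl), (hs'.setN le_rfl _).setN (by omega) _, ?_⟩
      simp [h0, h1, h2, h3]; ring)
    (by
      rintro σ' ⟨hs', h0, h1, h2, h3⟩
      simp [Test.eval, (hs.same hs').dom, h2])
    ⟨(((s₁.mono (by omega)).setN le_rfl _).setN (by omega) _).setN (by omega) _, by
      simp [v₁]⟩
  refine ⟨σ', (r₂.seq r₃).mono ?_, s₃, v₃⟩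
  simp; omega

theorem mul_dom_pow (h : IsNat d e) (m : ℕ) : IsNat d (fun E s => e E s * E.n ^ m) := by
  induction m with
  | zero => simpa using h
  | succ m ih => simpa [pow_succ, mul_assoc] using ih.mul_dom

theorem sum {ι : Type*} (S : Finset ι) {f : ι → Env L → Mem L → ℕ} (h : ∀ i ∈ S, IsNat d (f i)) :
    IsNat d (fun E s => ∑ i ∈ S, f i E s) := by
  classical
  induction S using Finset.induction_on with
  | empty => simpa using const d 0
  | insert a S ha ih =>
    simp only [Finset.sum_insert ha]
    exact (h a (by simp)).add (ih fun i hi => h i (by simp [hi]))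

end IsNat

namespace IsReal

variable {d : ℕ} {e e₁ e₂ : Env L → Mem L → ℝ≥0} {k k₁ k₂ : Env L → Mem L → ℕ}

theorem cast (h : IsNat d k) : IsReal d (fun E s => (k E s : ℝ≥0)) := by
  intro j
  obtain ⟨p, T, h⟩ := h j
  refine ⟨.seq p (.instr (.rcast (3 * j + 2) (3 * j + 3))), T + .C 2, fun E s σ hs => ?_⟩
  obtain ⟨σ₁, r₁, s₁, v₁⟩ := h E s σ hs
  exact ⟨_, (r₁.seq (Runs.instr rfl)).mono (by simp), s₁.setR le_rfl _, by simp [v₁]⟩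

theorem const (d k : ℕ) : IsReal (L := L) d (fun _ _ => (k : ℝ≥0)) := cast (IsNat.const d k)

theorem one (d : ℕ) : IsReal (L := L) d (fun _ _ => 1) := by simpa using const d 1

theorem zero (d : ℕ) : IsReal (L := L) d (fun _ _ => 0) := by simpa using const d 0

theorem pos (d : ℕ) (P : Predicate L) : IsReal d (fun E _ => E.W.pos P) := fun j =>
  ⟨.instr (.weightPos (3 * j + 2) P), .C 1, fun E s σ _ =>
    ⟨_, (Runs.instr rfl).mono (by simp), (Same.refl j σ).setR le_rfl _, by simp⟩⟩

theorem neg (d : ℕ) (P : Predicate L) : IsReal d (fun E _ => E.W.neg P) := fun j =>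
  ⟨.instr (.weightNeg (3 * j + 2) P), .C 1, fun E s σ _ =>
    ⟨_, (Runs.instr rfl).mono (by simp), (Same.refl j σ).setR le_rfl _, by simp⟩⟩

theorem tab (h : IsNat d k) : IsReal d (fun E s => s.tab (k E s)) := by
  intro j
  obtain ⟨p, T, h⟩ := ((h.add h).add h) j
  refine ⟨.seq p (.instr (.rload (3 * j + 2) (3 * j + 3))), T + .C 2, fun E s σ hs => ?_⟩
  obtain ⟨σ₁, r₁, s₁, v₁⟩ := h E s σ hs
  refine ⟨_, (r₁.seq (Runs.instr rfl)).mono (by simp), s₁.setR le_rfl _, ?_⟩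
  simp [v₁, ← (hs.same s₁).tab]
  congr 1; ring

theorem binop (I : ℕ → ℕ → ℕ → Instr L) (f : ℝ≥0 → ℝ≥0 → ℝ≥0) (f' : ℝ → ℝ → ℝ)
    (hI : ∀ W a b c σ, (I a b c).exec W σ = PMF.pure (σ.setR a (f' (σ.R b) (σ.R c))))
    (hf : ∀ x y : ℝ≥0, f' x y = f x y)
    (h₁ : IsReal d e₁) (h₂ : IsReal d e₂) : IsReal d (fun E s => f (e₁ E s) (e₂ E s)) := by
  intro j
  obtain ⟨p₁, T₁, h₁⟩ := h₁ j
  obtain ⟨p₂, T₂, h₂⟩ := h₂ (j + 1)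
  refine ⟨.seq (.seq p₁ p₂) (.instr (I (3 * j + 2) (3 * j + 2) (3 * (j + 1) + 2))),
    T₁ + T₂ + .C 3, fun E s σ hs => ?_⟩
  obtain ⟨σ₁, r₁, s₁, v₁⟩ := h₁ E s σ hs
  obtain ⟨σ₂, r₂, s₂, v₂⟩ := h₂ E s σ₁ (hs.same s₁)
  refine ⟨_, ((r₁.seq r₂).seq (Runs.instr (hI _ _ _ _ _))).mono ?_,
    (s₁.trans (s₂.mono (by omega))).setR le_rfl _, ?_⟩
  · simp; omega
  · simp [v₂, s₂.tempR, v₁, hf]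

theorem add (h₁ : IsReal d e₁) (h₂ : IsReal d e₂) : IsReal d (fun E s => e₁ E s + e₂ E s) :=
  binop .radd (· + ·) (· + ·) (fun _ _ _ _ _ => rfl) (fun _ _ => by simp) h₁ h₂

theorem mul (h₁ : IsReal d e₁) (h₂ : IsReal d e₂) : IsReal d (fun E s => e₁ E s * e₂ E s) :=
  binop .rmul (· * ·) (· * ·) (fun _ _ _ _ _ => rfl) (fun _ _ => by simp) h₁ h₂

theorem div (h₁ : IsReal d e₁) (h₂ : IsReal d e₂) : IsReal d (fun E s => e₁ E s / e₂ E s) :=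
  binop .rdiv (· / ·) (· / ·) (fun _ _ _ _ _ => rfl) (fun _ _ => by simp) h₁ h₂

theorem sum {ι : Type*} (S : Finset ι) {f : ι → Env L → Mem L → ℝ≥0}
    (h : ∀ i ∈ S, IsReal d (f i)) : IsReal d (fun E s => ∑ i ∈ S, f i E s) := by
  classical
  induction S using Finset.induction_on with
  | empty => simpa using zero d
  | insert a S ha ih =>
    simp only [Finset.sum_insert ha]
    exact (h a (by simp)).add (ih fun i hi => h i (by simp [hi]))

theorem prod {ι : Type*} (S : Finset ι) {f : ι → Env L → Mem L → ℝ≥0}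
    (h : ∀ i ∈ S, IsReal d (f i)) : IsReal d (fun E s => ∏ i ∈ S, f i E s) := by
  classical
  induction S using Finset.induction_on with
  | empty => simpa using one d
  | insert a S ha ih =>
    simp only [Finset.prod_insert ha]
    exact (h a (by simp)).mul (ih fun i hi => h i (by simp [hi]))

theorem ite_lt (h₁ : IsNat d k₁) (h₂ : IsNat d k₂) (h₃ : IsReal d e₁) (h₄ : IsReal d e₂) :
    IsReal d (fun E s => if k₁ E s < k₂ E s then e₁ E s else e₂ E s) := by
  intro j
  obtain ⟨p₁, T₁, h₁⟩ := h₁ j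
  obtain ⟨p₂, T₂, h₂⟩ := h₂ (j + 1)
  obtain ⟨p₃, T₃, h₃⟩ := h₃ j
  obtain ⟨p₄, T₄, h₄⟩ := h₄ j
  refine ⟨.seq (.seq p₁ p₂) (.ite (.natLt (3 * j + 3) (3 * (j + 1) + 3)) p₃ p₄),
    T₁ + T₂ + T₃ + T₄ + .C 3, fun E s σ hs => ?_⟩
  obtain ⟨σ₁, r₁, s₁, v₁⟩ := h₁ E s σ hs
  obtain ⟨σ₂, r₂, s₂, v₂⟩ := h₂ E s σ₁ (hs.same s₁)
  have hs₂ := (hs.same s₁).same s₂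
  have ht : Test.eval (.natLt (3 * j + 3) (3 * (j + 1) + 3)) σ₂
      = decide (k₁ E s < k₂ E s) := by
    simp [Test.eval, v₂, s₂.tempN, v₁]
  by_cases hlt : k₁ E s < k₂ E s
  · obtain ⟨σ₃, r₃, s₃, v₃⟩ := h₃ E s σ₂ hs₂
    refine ⟨σ₃, ((r₁.seq r₂).seq (Runs.ite (T := T₃.eval E.n) (σ' := σ₃) ?_)).mono ?_,
      (s₁.trans (s₂.mono (by omega))).trans s₃, by simp [hlt, v₃]⟩
    · simpa [ht, hlt] using r₃
    · simp; omega
  · obtain ⟨σ₃, r₃, s₃, v₃⟩ := h₄ E s σ₂ hs₂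
    refine ⟨σ₃, ((r₁.seq r₂).seq (Runs.ite (T := T₄.eval E.n) (σ' := σ₃) ?_)).mono ?_,
      (s₁.trans (s₂.mono (by omega))).trans s₃, by simp [hlt, v₃]⟩
    · simpa [ht, hlt] using r₃
    · simp; omega

/-- The time bound must hold in every memory, including those with huge counters, so the exponent is
capped at `n`. In the memories that matter the counters never exceed `n` and the cap is void. -/
theorem pow_min (h : IsReal d e) (hk : IsNat d k) :
    IsReal d (fun E s => e E s ^ min (k E s) E.n) := by
  intro j
  obtain ⟨p, T, h⟩ := h (j + 1)
  -- With truncated subtraction, `n - (n - k) = min k n`.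
  obtain ⟨q, T', h'⟩ := ((IsNat.dom d).sub ((IsNat.dom d).sub hk)) (j + 2)
  refine ⟨.seq (.seq p (.seq q (.seq (.instr (.const (3 * (j + 3) + 3) 0))
      (.seq (.instr (.const (3 * (j + 4) + 3) 1))
        (.instr (.rcast (3 * j + 2) (3 * (j + 4) + 3)))))))
    (.loop (.natLt (3 * (j + 3) + 3) (3 * (j + 2) + 3))
      (.seq (.instr (.rmul (3 * j + 2) (3 * j + 2) (3 * (j + 1) + 2)))
        (.instr (.add (3 * (j + 3) + 3) (3 * (j + 3) + 3) (3 * (j + 4) + 3))))),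
    T + T' + .C 4 * .X + .C 9, fun E s σ hs => ?_⟩
  obtain ⟨σ₁, r₁, s₁, v₁⟩ := h E s σ hs
  obtain ⟨σ₂, r₂, s₂, v₂⟩ := h' E s σ₁ (hs.same s₁)
  replace v₂ : σ₂.N (3 * (j + 2) + 3) = min (k E s) E.n := by rw [v₂]; dsimp only; omega
  have hv : σ₂.R (3 * (j + 1) + 2) = e E s := by rw [s₂.tempR (by omega), v₁]
  have r₃ := r₁.seq (r₂.seq ((Runs.instr (i := .const (3 * (j + 3) + 3) 0) rfl).seq
    ((Runs.instr (i := .const (3 * (j + 4) + 3) 1) rfl).seq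
      (Runs.instr (i := .rcast (3 * j + 2) (3 * (j + 4) + 3)) rfl))))
  obtain ⟨σ', r₄, s₄, v₄, -⟩ := Runs.loop (W := E.W)
    (t := .natLt (3 * (j + 3) + 3) (3 * (j + 2) + 3))
    (p := .seq (.instr (.rmul (3 * j + 2) (3 * j + 2) (3 * (j + 1) + 2)))
        (.instr (.add (3 * (j + 3) + 3) (3 * (j + 3) + 3) (3 * (j + 4) + 3)))) (T := 3)
    (σ := ((σ₂.setN (3 * (j + 3) + 3) 0).setN (3 * (j + 4) + 3) 1).setR (3 * j + 2)
      (((σ₂.setN (3 * (j + 3) + 3) 0).setN (3 * (j + 4) + 3) 1).N (3 * (j + 4) + 3) : ℝ))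
    (fun i σ' => Same j σ σ' ∧ σ'.R (3 * j + 2) = ((e E s ^ i : ℝ≥0) : ℝ) ∧
      σ'.R (3 * (j + 1) + 2) = e E s ∧ σ'.N (3 * (j + 2) + 3) = min (k E s) E.n ∧
      σ'.N (3 * (j + 3) + 3) = i ∧ σ'.N (3 * (j + 4) + 3) = 1) (min (k E s) E.n)
    (by
      rintro i hi σ' ⟨hs', h0, h1, h2, h3, h4⟩
      refine ⟨by rw [Test.eval, h2, h3]; simpa using hi, _,
        (Runs.instr rfl).seq (Runs.instr rfl), (hs'.setR le_rfl _).setN (by omega) _, ?_⟩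
      simp [h0, h1, h2, h3, h4, pow_succ])
    (by
      rintro σ' ⟨hs', h0, h1, h2, h3, h4⟩
      simp [Test.eval, h2, h3])
    ⟨((((s₁.mono (by omega)).trans (s₂.mono (by omega))).setN
      (show j ≤ j + 3 by omega) 0).setN (show j ≤ j + 4 by omega) 1).setR le_rfl _, by
      simp [v₂, hv]⟩
  refine ⟨σ', (r₃.seq r₄).mono ?_, s₄, v₄⟩
  have : min (k E s) E.n * 4 ≤ E.n * 4 := Nat.mul_le_mul_right _ (min_le_right _ _)
  simp; omega

end IsReal

end Machine

/-! ### Randomized commands and their simulation by programs -/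

section Commands

variable {L : FirstOrder.Language.{u, v}}

/-! ### Commands

A command is given by its expectation transformer: `c g s` is the expectation of `g` after `c` has
been run from the memory `s`. -/

/-- Expectation transformers. -/
abbrev WP (L : FirstOrder.Language.{u, v}) : Type v := (Mem L → ℝ≥0∞) → Mem L → ℝ≥0∞

open Classical in
/-- Change the counter of a cell. -/
def Mem.setCount (s : Mem L) (c : Cell L) (k : ℕ) : Mem L :=
  { s with count := fun c' => if c' = c then k else s.count c' }

/-- Change an entry of the table. -/
def Mem.setTab (s : Mem L) (i : ℕ) (x : ℝ≥0) : Mem L :=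
  { s with tab := fun i' => if i' = i then x else s.tab i' }

/-- Change an entry of the list of cells. -/
def Mem.setCell (s : Mem L) (i : ℕ) (c : Cell L) : Mem L :=
  { s with cell := fun i' => if i' = i then c else s.cell i' }

open Classical in
/-- Output a ground literal. -/
def Mem.put (s : Mem L) (a : GroundAtom L ℕ) (b : Bool) : Mem L :=
  { s with out := fun a' => if a' = a then b else s.out a' }

/-- With probability `x` (clamped to `[0, 1]`) run `c₁`, otherwise run `c₂`. -/
def WP.flip (x : ℝ≥0) (c₁ c₂ : WP L) : WP L := fun g s =>
  ((min x 1 : ℝ≥0) : ℝ≥0∞) * c₁ g s + ((1 - min x 1 : ℝ≥0) : ℝ≥0∞) * c₂ g s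

/-- Run `c a` for all elements `a` of a list. -/
def WP.forList {α : Type*} (l : List α) (c : α → WP L) : WP L := fun g => l.foldr c g

variable [Fintype (Predicate L)]

theorem Rel.of_succ {d t : ℕ} {E : Env L} {s : Mem L} {σ : State L}
    (h : Rel (d + 1) (E.push d t) s σ) : Rel d E s σ where
  dom := h.dom
  count := h.count
  var e he := (h.var e (by omega)).trans (E.push_var_of_ne t (by omega))
  tab := h.tab
  cell := h.cell
  out := h.out

theorem Rel.succ {d t : ℕ} {E : Env L} {s : Mem L} {σ : State L} (h : Rel d E s σ)
    (ht : σ.N (3 * d + 2) = t) : Rel (d + 1) (E.push d t) s σ where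
  dom := h.dom
  count := h.count
  var e he := by
    rcases Nat.lt_succ_iff_lt_or_eq.1 he with h' | rfl
    · rw [h.var e h', E.push_var_of_ne t (by omega)]
    · simpa using ht
  tab := h.tab
  cell := h.cell
  out := h.out

theorem Rel.setVar {d t : ℕ} {E : Env L} {s : Mem L} {σ : State L} (h : Rel d E s σ) :
    Rel (d + 1) (E.push d t) s (σ.setN (3 * d + 2) t) := by
  refine Rel.succ ⟨?_, fun c => ?_, fun e he => ?_, h.tab, h.cell, h.out⟩ (by simp)
  · rw [State.setN_N, if_neg (by omega), h.dom]
  · rw [State.setN_N, if_neg (by omega), h.count]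
  · rw [State.setN_N, if_neg (by omega), h.var e he]

/-- Within `T` steps the program `p` does what the command `c` describes. -/
def Sim (d : ℕ) (E : Env L) (p : Prog L) (T : ℕ) (c : WP L) : Prop :=
  ∀ (K : List (Prog L)) (m : ℕ) (Φ : Config L → ℝ≥0∞) (g : Mem L → ℝ≥0∞),
    (∀ s σ, Rel d E s σ → ∀ t ≥ m, expect (run E.W t ⟨K, σ⟩) Φ = g s) →
    ∀ s σ, Rel d E s σ → ∀ t ≥ T + m, expect (run E.W t ⟨p :: K, σ⟩) Φ = c g s

/-- The command `c` can be executed in polynomial time. -/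
def IsCmd (d : ℕ) (c : Env L → WP L) : Prop :=
  ∃ (p : Prog L) (T : Polynomial ℕ), ∀ E, Sim d E p (T.eval E.n) (c E)

omit [Fintype (Predicate L)] in
theorem Runs.expect_eq {W : Weighting L} {p : Prog L} {σ σ' : State L} {T m : ℕ}
    {K : List (Prog L)} {Φ : Config L → ℝ≥0∞} {x : ℝ≥0∞} (h : Runs W p σ T σ')
    (hx : ∀ t ≥ m, expect (run W t ⟨K, σ'⟩) Φ = x) :
    ∀ t ≥ T + m, expect (run W t ⟨p :: K, σ⟩) Φ = x := by
  obtain ⟨τ, hτ, h⟩ := h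
  intro t ht
  obtain ⟨t, rfl⟩ : ∃ t', t = t' + τ := ⟨t - τ, by omega⟩
  rw [h, hx _ (by omega)]

omit [Fintype (Predicate L)] in
theorem expect_run_seq {W : Weighting L} {p q : Prog L} {σ : State L} {m : ℕ}
    {K : List (Prog L)} {Φ : Config L → ℝ≥0∞} {x : ℝ≥0∞}
    (h : ∀ t ≥ m, expect (run W t ⟨p :: q :: K, σ⟩) Φ = x) :
    ∀ t ≥ m + 1, expect (run W t ⟨.seq p q :: K, σ⟩) Φ = x := by
  intro t ht
  obtain ⟨t, rfl⟩ : ∃ t', t = t' + 1 := ⟨t - 1, by omega⟩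
  rw [run, step, PMF.pure_bind, h _ (by omega)]

omit [Fintype (Predicate L)] in
theorem expect_run_ite {W : Weighting L} {t₀ : Test} {p q : Prog L} {σ : State L} {m : ℕ}
    {K : List (Prog L)} {Φ : Config L → ℝ≥0∞} {x : ℝ≥0∞}
    (h : ∀ t ≥ m, expect (run W t ⟨(if t₀.eval σ = true then p else q) :: K, σ⟩) Φ = x) :
    ∀ t ≥ m + 1, expect (run W t ⟨.ite t₀ p q :: K, σ⟩) Φ = x := by
  intro t ht
  obtain ⟨t, rfl⟩ : ∃ t', t = t' + 1 := ⟨t - 1, by omega⟩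
  rw [run, step, PMF.pure_bind, h _ (by omega)]

namespace IsCmd

variable {d : ℕ} {c c₁ c₂ : Env L → WP L} {k k₁ k₂ : Env L → Mem L → ℕ}
  {e e₁ e₂ : Env L → Mem L → ℝ≥0}

theorem of_runs (F : Env L → Mem L → Mem L)
    (h : ∃ (p : Prog L) (T : Polynomial ℕ), ∀ E s σ, Rel d E s σ →
      ∃ σ', Runs E.W p σ (T.eval E.n) σ' ∧ Rel d E (F E s) σ') :
    IsCmd d (fun E g s => g (F E s)) := by
  obtain ⟨p, T, h⟩ := h
  refine ⟨p, T, fun E K m Φ g hg s σ hs => ?_⟩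
  obtain ⟨σ', hr, hs'⟩ := h E s σ hs
  exact hr.expect_eq (hg _ σ' hs')

theorem skip (d : ℕ) : IsCmd (L := L) d (fun _ g => g) :=
  of_runs (fun _ s => s) ⟨.instr (.const 3 0), .C 1, fun E s σ hs =>
    ⟨_, (Runs.instr rfl).mono (by simp),
      hs.same ((Same.refl 0 σ).setN (i := 0) le_rfl 0)⟩⟩

theorem put (P : Predicate L) (a : Fin P.1 → ℕ) (ha : ∀ i, a i < d) (b : Bool) :
    IsCmd d (fun E g s => g (s.put ⟨P, fun i => E.var (a i)⟩ b)) := by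
  refine of_runs (fun E s => s.put ⟨P, fun i => E.var (a i)⟩ b)
    ⟨.seq (.instr (.const 3 (if b = true then 1 else 0)))
      (.instr (.put P (fun i => 3 * a i + 2) 3)), .C 3, fun E s σ hs => ?_⟩
  have hs₁ := hs.same ((Same.refl 0 σ).setN (i := 0) le_rfl (if b = true then 1 else 0))
  have r := (Runs.instr (W := E.W) (i := .const 3 (if b = true then 1 else 0)) (σ := σ) rfl).seq
    (Runs.instr (i := .put P (fun i => 3 * a i + 2) 3) rfl)
  refine ⟨_, r.mono (by simp), ⟨hs₁.dom, hs₁.count, hs₁.var, hs₁.tab, hs₁.cell, ?_⟩⟩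
  have h1 : ∀ i, (σ.setN 3 (if b = true then 1 else 0)).N (3 * a i + 2) = E.var (a i) :=
    fun i => hs₁.var _ (ha i)
  have h2 : decide ((σ.setN 3 (if b = true then 1 else 0)).N 3 ≠ 0) = b := by
    cases b <;> simp
  simp only [h1, h2]
  funext α
  simp [State.setOut, Mem.put, Function.update_apply, hs.out]

theorem setCount (c : Cell L) (h : IsNat d k) :
    IsCmd d (fun E g s => g (s.setCount c (k E s))) := by
  obtain ⟨p, T, h⟩ := h 0
  refine of_runs (fun E s => s.setCount c (k E s))
    ⟨.seq p (.seq (.instr (.const 6 0)) (.instr (.add (3 * (enc c : ℕ) + 1) 3 6))), T + .C 4,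
      fun E s σ hs => ?_⟩
  obtain ⟨σ₁, r₁, s₁, v₁⟩ := h E s σ hs
  replace v₁ : σ₁.N 3 = k E s := v₁
  have hs₁ := hs.same s₁
  have r := r₁.seq ((Runs.instr (i := .const 6 0) rfl).seq
    (Runs.instr (i := .add (3 * (enc c : ℕ) + 1) 3 6) rfl))
  refine ⟨_, r.mono (by simp), ?_, fun c' => ?_, fun e he => ?_, hs₁.tab, hs₁.cell, hs₁.out⟩
  · simp [hs₁.dom]
  · have : (enc c' : ℕ) = enc c ↔ c' = c := by rw [← Fin.ext_iff]; simp
    simp only [State.setN_N, Mem.setCount]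
    by_cases hc : c' = c
    · simp [hc, v₁]
    · have hne := mt this.1 hc
      rw [if_neg (by omega), if_neg (by omega), if_neg hc, hs₁.count]
  · simp only [State.setN_N]
    rw [if_neg (by omega), if_neg (by omega), hs₁.var e he]

theorem setTab (hk : IsNat d k) (he : IsReal d e) :
    IsCmd d (fun E g s => g (s.setTab (k E s) (e E s))) := by
  obtain ⟨p, T, h⟩ := ((hk.add hk).add hk) 0
  obtain ⟨q, T', h'⟩ := he 1
  refine of_runs (fun E s => s.setTab (k E s) (e E s))
    ⟨.seq p (.seq q (.instr (.rstore 3 5))), T + T' + .C 3, fun E s σ hs => ?_⟩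
  obtain ⟨σ₁, r₁, s₁, v₁⟩ := h E s σ hs
  obtain ⟨σ₂, r₂, s₂, v₂⟩ := h' E s σ₁ (hs.same s₁)
  have hs₂ := (hs.same s₁).same s₂
  have h3 : σ₂.N 3 = k E s + k E s + k E s :=
    (s₂.tempN (i := 0) (by omega)).trans v₁
  replace v₂ : σ₂.R 5 = e E s := v₂
  have r := r₁.seq (r₂.seq (Runs.instr (i := .rstore 3 5) rfl))
  refine ⟨_, r.mono (by simp; omega), hs₂.dom,
    hs₂.count, hs₂.var, fun i => ?_, fun i => ?_, hs₂.out⟩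
  · simp only [State.setR_R, Mem.setTab, h3, v₂]
    by_cases hi : i = k E s
    · rw [if_pos (by omega), if_pos hi]
    · rw [if_neg (by omega), if_neg hi, hs₂.tab]
  · simp only [State.setR_R, h3]
    rw [if_neg (by omega), hs₂.cell]
    rfl

theorem setCell (hk : IsNat d k) (c : Cell L) :
    IsCmd d (fun E g s => g (s.setCell (k E s) c)) := by
  obtain ⟨p, T, h⟩ := (((hk.add hk).add hk).add (IsNat.const d 1)) 0
  refine of_runs (fun E s => s.setCell (k E s) c)
    ⟨.seq p (.seq (.instr (.const 6 (enc c))) (.seq (.instr (.rcast 5 6))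
      (.instr (.rstore 3 5)))), T + .C 6, fun E s σ hs => ?_⟩
  obtain ⟨σ₁, r₁, s₁, v₁⟩ := h E s σ hs
  replace v₁ : σ₁.N 3 = k E s + k E s + k E s + 1 := v₁
  have hs₁ := hs.same ((s₁.setN (show 0 ≤ 1 by omega) (enc c)).setR (show 0 ≤ 1 by omega)
    ((enc c : ℕ) : ℝ))
  have r := r₁.seq ((Runs.instr (i := .const 6 (enc c)) rfl).seq ((Runs.instr (i := .rcast 5 6)
    (σ' := (σ₁.setN 6 (enc c)).setR 5 ((enc c : ℕ) : ℝ)) (by simp [Instr.exec])).seq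
      (Runs.instr (i := .rstore 3 5) rfl)))
  refine ⟨_, r.mono (by simp), hs₁.dom, hs₁.count, hs₁.var, fun i => ?_, fun i => ?_, hs₁.out⟩
  · rw [State.setR_R, if_neg]
    · exact hs₁.tab i
    · simp [v₁]; omega
  · rw [State.setR_R]
    have h3 : ((σ₁.setN 6 (enc c)).setR 5 ((enc c : ℕ) : ℝ)).N 3 = 3 * k E s + 1 := by
      simp [v₁]; omega
    rw [h3]
    by_cases hi : i = k E s
    · simp [hi, Mem.setCell]
    · rw [if_neg (by omega)]
      simpa [Mem.setCell, hi] using hs₁.cell i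

theorem seq (h₁ : IsCmd d c₁) (h₂ : IsCmd d c₂) : IsCmd d (fun E g => c₁ E (c₂ E g)) := by
  obtain ⟨p, T, h⟩ := h₁
  obtain ⟨q, T', h'⟩ := h₂
  refine ⟨.seq p q, T + T' + .C 1, fun E K m Φ g hg s σ hs t ht => ?_⟩
  refine expect_run_seq (m := T.eval E.n + (T'.eval E.n + m)) (fun t ht => ?_) t ?_
  · exact h E _ _ Φ _ (fun s σ hs => h' E K m Φ g hg s σ hs) s σ hs t ht
  · simp at ht; omega

theorem forList {α : Type*} (l : List α) {c : α → Env L → WP L} (h : ∀ a ∈ l, IsCmd d (c a)) :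
    IsCmd d (fun E => WP.forList l (fun a => c a E)) := by
  induction l with
  | nil => exact skip d
  | cons a l ih => exact (h a (by simp)).seq (ih fun a ha => h a (by simp [ha]))

theorem ite_lt (hk₁ : IsNat d k₁) (hk₂ : IsNat d k₂) (h₁ : IsCmd d c₁) (h₂ : IsCmd d c₂) :
    IsCmd d (fun E g s => if k₁ E s < k₂ E s then c₁ E g s else c₂ E g s) := by
  obtain ⟨p₁, T₁, hk₁⟩ := hk₁ 0
  obtain ⟨p₂, T₂, hk₂⟩ := hk₂ 1
  obtain ⟨p₃, T₃, h₁⟩ := h₁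
  obtain ⟨p₄, T₄, h₂⟩ := h₂
  refine ⟨.seq (.seq p₁ p₂) (.ite (.natLt 3 6) p₃ p₄), T₁ + T₂ + T₃ + T₄ + .C 3,
    fun E K m Φ g hg s σ hs t ht => ?_⟩
  obtain ⟨σ₁, r₁, s₁, v₁⟩ := hk₁ E s σ hs
  obtain ⟨σ₂, r₂, s₂, v₂⟩ := hk₂ E s σ₁ (hs.same s₁)
  have hs₂ := (hs.same s₁).same s₂
  have h3 : σ₂.N 3 = k₁ E s := (s₂.tempN (i := 0) (by omega)).trans v₁
  replace v₂ : σ₂.N 6 = k₂ E s := v₂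
  refine expect_run_seq ((r₁.seq r₂).expect_eq (expect_run_ite
    (m := T₃.eval E.n + T₄.eval E.n + m) fun t ht => ?_)) t (by simp at ht ⊢; omega)
  by_cases hlt : k₁ E s < k₂ E s
  · simp only [Test.eval, h3, v₂, hlt, decide_true, if_true]
    exact h₁ E K m Φ g hg s σ₂ hs₂ t (by omega)
  · simp only [Test.eval, h3, v₂, hlt, decide_false, if_false, Bool.false_eq_true]
    exact h₂ E K m Φ g hg s σ₂ hs₂ t (by omega)

theorem ite_cell (hk : IsNat d k) (a : Cell L) (h₁ : IsCmd d c₁) (h₂ : IsCmd d c₂) :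
    IsCmd d (fun E g s => if s.cell (k E s) = a then c₁ E g s else c₂ E g s) := by
  obtain ⟨p, T, h⟩ := (((hk.add hk).add hk).add (IsNat.const d 1)) 0
  obtain ⟨p₁, T₁, h₁⟩ := h₁
  obtain ⟨p₂, T₂, h₂⟩ := h₂
  -- Cell codes are stored as reals, which can only be compared by `<`; equality is the failure of
  -- both strict comparisons.
  refine ⟨.seq (.seq p (.seq (.instr (.rload 2 3)) (.seq (.instr (.const 6 (enc a)))
      (.instr (.rcast 5 6))))) (.ite (.realLt 2 5) p₂ (.ite (.realLt 5 2) p₂ p₁)),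
    T + T₁ + T₂ + .C 9, fun E K m Φ g hg s σ hs t ht => ?_⟩
  obtain ⟨σ₁, r₁, s₁, v₁⟩ := h E s σ hs
  replace v₁ : σ₁.N 3 = 3 * k E s + 1 := v₁.trans (by dsimp only; omega)
  obtain ⟨σ₂, r₂, hs₂, h2, h5⟩ : ∃ σ₂, Runs E.W (.seq p (.seq (.instr (.rload 2 3))
      (.seq (.instr (.const 6 (enc a))) (.instr (.rcast 5 6))))) σ (T.eval E.n + 6) σ₂ ∧
      Rel d E s σ₂ ∧ σ₂.R 2 = ((enc (s.cell (k E s)) : ℕ) : ℝ) ∧ σ₂.R 5 = ((enc a : ℕ) : ℝ) := by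
    have r₂ := r₁.seq ((Runs.instr (i := .rload 2 3) rfl).seq
      ((Runs.instr (i := .const 6 (enc a)) rfl).seq (Runs.instr (i := .rcast 5 6) rfl)))
    refine ⟨_, r₂, hs.same (((s₁.setR (i := 0) le_rfl (σ₁.R (σ₁.N 3))).setN
      (show 0 ≤ 1 by omega) (enc a)).setR (show 0 ≤ 1 by omega) _), ?_, ?_⟩
    · simpa [v₁] using (hs.same s₁).cell (k E s)
    · simp
  refine expect_run_seq (r₂.expect_eq (expect_run_ite
    (m := T₁.eval E.n + T₂.eval E.n + 1 + m) fun t ht => ?_)) t (by simp at ht ⊢; omega)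
  simp only [Test.eval, h2, h5, Nat.cast_lt, decide_eq_true_eq]
  by_cases heq : s.cell (k E s) = a
  · simp only [heq, lt_irrefl, if_false, if_true]
    refine expect_run_ite (m := T₁.eval E.n + T₂.eval E.n + m) (fun t ht => ?_) t (by omega)
    simp only [Test.eval, h2, h5, heq, lt_irrefl, decide_false, Bool.false_eq_true, if_false]
    exact h₁ E K m Φ g hg s σ₂ hs₂ t (by omega)
  · have hne : (enc (s.cell (k E s)) : ℕ) ≠ enc a := by
      rw [Ne, ← Fin.ext_iff]; simpa using heq
    rw [if_neg heq]
    split_ifs with hlt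
    · exact h₂ E K m Φ g hg s σ₂ hs₂ t (by omega)
    · refine expect_run_ite (m := T₁.eval E.n + T₂.eval E.n + m) (fun t ht => ?_) t (by omega)
      have : (enc a : ℕ) < enc (s.cell (k E s)) := by omega
      simp only [Test.eval, h2, h5, Nat.cast_lt, this, decide_true, if_true]
      exact h₂ E K m Φ g hg s σ₂ hs₂ t (by omega)

/-- The two branches may need different times. As `Sim` speaks of all sufficiently long runs, the
sum of both bounds serves for either. -/
theorem flip (he : IsReal d e) (h₁ : IsCmd d c₁) (h₂ : IsCmd d c₂) :
    IsCmd d (fun E g s => WP.flip (e E s) (c₁ E) (c₂ E) g s) := by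
  obtain ⟨p, T, he⟩ := he 0
  obtain ⟨p₁, T₁, h₁⟩ := h₁
  obtain ⟨p₂, T₂, h₂⟩ := h₂
  refine ⟨.seq p (.seq (.instr (.flip 3 2)) (.seq (.instr (.const 6 0))
    (.ite (.natLt 6 3) p₁ p₂))), T + T₁ + T₂ + .C 6, fun E K m Φ g hg s σ hs t ht => ?_⟩
  obtain ⟨σ₁, r₁, s₁, v₁⟩ := he E s σ hs
  replace v₁ : σ₁.R 2 = e E s := v₁
  have key : ∀ b : Bool, ∀ t ≥ T₁.eval E.n + T₂.eval E.n + 3 + m,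
      expect (run E.W t ⟨.seq (.instr (.const 6 0)) (.ite (.natLt 6 3) p₁ p₂) :: K,
        σ₁.setN 3 (if b = true then 1 else 0)⟩) Φ = if b = true then c₁ E g s else c₂ E g s := by
    intro b t ht
    have hs₂ := hs.same ((s₁.setN (i := 0) le_rfl (if b = true then 1 else 0)).setN
      (show 0 ≤ 1 by omega) 0)
    refine expect_run_seq ((Runs.instr rfl).expect_eq (expect_run_ite
      (m := T₁.eval E.n + T₂.eval E.n + m) fun t ht => ?_)) t (by omega)
    cases b
    · simpa [Test.eval] using h₂ E K m Φ g hg s _ hs₂ t (by omega)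
    · simpa [Test.eval] using h₁ E K m Φ g hg s _ hs₂ t (by omega)
  refine expect_run_seq (r₁.expect_eq
    (m := T₁.eval E.n + T₂.eval E.n + 5 + m) fun t ht => ?_) t (by simp at ht ⊢; omega)
  refine expect_run_seq (m := T₁.eval E.n + T₂.eval E.n + 4 + m) (fun t ht => ?_) t (by omega)
  obtain ⟨t, rfl⟩ : ∃ t', t = t' + 1 := ⟨t - 1, by omega⟩
  rw [run, step, Instr.exec, expect_bind, expect_map, expect_map, v₁, expect_coin,
    key true t (by omega), key false t (by omega)]
  simp [WP.flip]

theorem loop (h : IsCmd (d + 1) c) :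
    IsCmd d (fun E => WP.forList (List.range E.n) (fun t => c (E.push d t))) := by
  obtain ⟨p, T, h⟩ := h
  refine ⟨.seq (.instr (.const (3 * d + 2) 0)) (.loop (.natLt (3 * d + 2) 0)
    (.seq p (.seq (.instr (.const 3 1)) (.instr (.add (3 * d + 2) (3 * d + 2) 3))))),
    .X * (T + .C 5) + .C 3, fun E K m Φ g hg s σ hs t ht => ?_⟩
  -- Induction on the number `k` of remaining rounds, in which the loop variable is `n - k`. The 5
  -- extra steps per round are the test, two sequencings and the two-instruction increment with one
  -- sequencing less its share in the body: in total one test, two `seq` and two instructions.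
  have key : ∀ k ≤ E.n, ∀ s σ, Rel (d + 1) (E.push d (E.n - k)) s σ →
      ∀ t ≥ k * (T.eval E.n + 5) + 1 + m,
      expect (run E.W t ⟨.loop (.natLt (3 * d + 2) 0)
        (.seq p (.seq (.instr (.const 3 1)) (.instr (.add (3 * d + 2) (3 * d + 2) 3)))) :: K, σ⟩) Φ
        = WP.forList (List.range' (E.n - k) k) (fun t => c (E.push d t)) g s := by
    intro k
    induction k with
    | zero =>
      intro _ s σ hs t ht
      have hd := hs.dom
      have hv := hs.var d (by omega)
      obtain ⟨t, rfl⟩ : ∃ t', t = t' + 1 := ⟨t - 1, by omega⟩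
      rw [run, step, PMF.pure_bind, if_neg (by simp [Test.eval, hd, hv]),
        hg s σ hs.of_succ t (by omega)]
      rfl
    | succ k ih =>
      intro hk s σ hs t ht
      have hd := hs.dom
      have hv := hs.var d (by omega)
      rw [add_mul] at ht
      obtain ⟨t, rfl⟩ : ∃ t', t = t' + 1 := ⟨t - 1, by omega⟩
      rw [run, step, PMF.pure_bind, if_pos (by simp [Test.eval, hd, hv]; omega),
        List.range'_succ]
      refine expect_run_seq (m := T.eval E.n + (k * (T.eval E.n + 5) + 4 + m))
        (fun t ht => ?_) t (by omega)
      refine h (E.push d (E.n - (k + 1))) _ (k * (T.eval E.n + 5) + 4 + m) Φ _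
        (fun s σ hs => ?_) s σ hs t ht
      have hs₁ := hs.same ((Same.refl 0 σ).setN (i := 0) le_rfl 1)
      have r := (Runs.instr (W := E.W) (i := .const 3 1) (σ := σ) rfl).seq
        (Runs.instr (i := .add (3 * d + 2) (3 * d + 2) 3) rfl)
      rw [show E.n - (k + 1) + 1 = E.n - k by omega]
      refine fun t ht => r.expect_eq (ih (by omega) s _ ?_) t (by omega)
      have hv := hs.var d (by omega)
      simp only [Env.push_var_self] at hv
      have : (σ.setN 3 1).N (3 * d + 2) + (σ.setN 3 1).N 3 = E.n - k := by
        simp [hv]; omega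
      rw [this]
      exact hs₁.of_succ.setVar
  refine expect_run_seq ((Runs.instr rfl).expect_eq (key E.n le_rfl s _ ?_)) t
    (by simp at ht ⊢; omega) |>.trans ?_
  · rw [Nat.sub_self]
    exact hs.setVar
  · simp only [Nat.sub_self, List.range_eq_range']

end IsCmd

end Commands

/-! ### The sampling algorithm and its running time -/

section Sampler

variable {L : FirstOrder.Language.{u, v}}

/-! ### The sampler -/

/-- Choose an element of a list with probability proportional to its weight, and run the command
of the chosen element. -/
def WP.choose {α : Type*} (w : α → ℝ≥0) (c : α → WP L) : List α → WP L
  | [] => fun g => g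
  | a :: l => WP.flip (w a / (w a + (l.map w).sum)) (c a) (WP.choose w c l)

/-- Run the command of the first element of the list that satisfies a condition. -/
def WP.switch {α : Type*} (p : α → Mem L → Prop) (c : α → WP L) : List α → WP L
  | [] => fun g => g
  | a :: l => fun g s => open Classical in if p a s then c a g s else WP.switch p c l g s

/-- Nested loops over the loop variables of depth `d, …, d + q - 1`. -/
def WP.forVars (c : Env L → WP L) : ℕ → ℕ → Env L → WP L
  | _, 0 => c
  | d, q + 1 => fun E => WP.forList (List.range E.n) (fun t => forVars c (d + 1) q (E.push d t))

/-- The world that is induced on `M'` by a map into the domain of `μ`. -/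
def World.pull {M M' : Type} (f : M' → M) (μ : World L M) : World L M' :=
  fun α => μ ⟨α.1, fun i => f (α.2 i)⟩

/-- The weight of a ground literal of `P`. -/
def Weighting.lit (W : Weighting L) (P : Predicate L) (b : Bool) : ℝ≥0 :=
  if b = true then W.pos P else W.neg P

/-- Both elements occur in the atom. -/
def IsMixed (α : GroundAtom L (Fin 2)) : Prop := (∃ i, α.2 i = 0) ∧ ∃ i, α.2 i = 1

variable [Fintype (Predicate L)]

/-- The weight of the nullary part of a cell. -/
def nullWeight (W : Weighting L) (j : Cell L) : ℝ≥0 :=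
  ∏ P : Predicate L, if P.1 = 0 then W.lit P (j ⟨P, fun _ => 0⟩) else 1

open Classical in
/-- The weight of a cell, without its nullary part. -/
def cellWeight [L.IsRelational] (Γ : L.Sentence) (W : Weighting L) (j : Cell L) : ℝ≥0 :=
  if j.Models Γ then ∏ P : Predicate L, if P.1 = 0 then 1 else W.lit P (j ⟨P, fun _ => 0⟩) else 0

open Classical in
/-- The weight of the mixed atoms of a world with two elements that have the cells `c` and `j`. -/
def pairWeight [L.IsRelational] (Γ : L.Sentence) (W : Weighting L) (c j : Cell L)
    (ω : World L (Fin 2)) : ℝ≥0 :=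
  if ω.pull (fun _ => 0) = c ∧ ω.pull (fun _ => 1) = j ∧ ω.Models Γ then
    ∏ α : GroundAtom L (Fin 2), if IsMixed α then W.lit α.1 (ω α) else 1
  else 0

/-- The total weight of the pairs of elements with cells `c` and `j`. -/
def linkWeight [L.IsRelational] (Γ : L.Sentence) (W : Weighting L) (c j : Cell L) : ℝ≥0 :=
  ∑ ω : World L (Fin 2), pairWeight Γ W c j ω

/-- The position of the vector `κ` in the table. -/
def index (n : ℕ) (κ : Cell L → ℕ) : ℕ := ∑ c, κ c * n ^ (enc c : ℕ)

omit [Fintype (Predicate L)] in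
open Classical in
/-- Count one more element with the cell `j`. -/
def incr (κ : Cell L → ℕ) (j : Cell L) : Cell L → ℕ := fun c => κ c + if c = j then 1 else 0

/-- The table entry of `κ`, where the entries of the vectors with sum at least `n` are `1`. -/
def entry (n : ℕ) (tab : ℕ → ℝ≥0) (κ : Cell L → ℕ) : ℝ≥0 :=
  if ∑ c, κ c < n then tab (index n κ) else 1

/-- The factor by which the weight of the cell `j` is multiplied if a new element with this cell
is added to elements whose cells are counted by `κ`. -/
def stepWeight [L.IsRelational] (Γ : L.Sentence) (W : Weighting L) (n : ℕ) (tab : ℕ → ℝ≥0)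
    (κ : Cell L → ℕ) (j : Cell L) : ℝ≥0 :=
  (∏ c, linkWeight Γ W c j ^ min (κ c) n) * entry n tab (incr κ j)

/-- Toss a coin for every ground atom. -/
def fillCmd (E : Env L) : WP L :=
  WP.forList (Finset.univ : Finset (Predicate L)).toList fun P =>
    WP.forVars (fun E : Env L => WP.flip (E.W.pos P / (E.W.pos P + E.W.neg P))
      (fun g s => g (s.put ⟨P, fun i => E.var i⟩ true))
      (fun g s => g (s.put ⟨P, fun i => E.var i⟩ false))) 0 P.1 E

/-- Recompute the table. -/
def sweepCmd [L.IsRelational] (Γ : L.Sentence) (d : ℕ) : Env L → WP L :=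
  WP.forVars (fun (E : Env L) g (s : Mem L) => g (s.setTab (index E.n fun c : Cell L => E.var (d + enc c))
    (∑ j : Cell L, cellWeight Γ E.W j * stepWeight Γ E.W E.n s.tab (fun c => E.var (d + enc c)) j)))
    d (Fintype.card (Cell L))

/-- Compute the table. -/
def tableCmd [L.IsRelational] (Γ : L.Sentence) (E : Env L) : WP L :=
  WP.forList (List.range E.n) fun t => sweepCmd Γ 1 (E.push 0 t)

/-- Output the cell `j` of the element `E.var 0`; nullary atoms are output for the first
element only. -/
def putCell (j : Cell L) (E : Env L) : WP L :=
  WP.forList (Finset.univ : Finset (Predicate L)).toList fun P =>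
    if P.1 = 0 then fun g s =>
      if E.var 0 < 1 then g (s.put ⟨P, fun _ => E.var 0⟩ (j ⟨P, fun _ => 0⟩)) else g s
    else fun g s => g (s.put ⟨P, fun _ => E.var 0⟩ (j ⟨P, fun _ => 0⟩))

open Classical in
/-- Output the mixed atoms of the elements `E.var 1` and `E.var 0`. -/
def putPair (ω : World L (Fin 2)) (E : Env L) : WP L :=
  WP.forList (Finset.univ : Finset (GroundAtom L (Fin 2))).toList fun α =>
    if IsMixed α then fun g s =>
      g (s.put ⟨α.1, fun i => E.var (if α.2 i = 1 then 0 else 1)⟩ (ω α))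
    else fun g => g

/-- Sample the mixed atoms of the elements `E.var 1` and `E.var 0`, if `E.var 1 < E.var 0`. The
latter has the cell `j`. -/
def pairCmd [L.IsRelational] (Γ : L.Sentence) (j : Cell L) (E : Env L) : WP L := fun g s =>
  if E.var 1 < E.var 0 then
    WP.switch (fun c s => s.cell (E.var 1) = c)
      (fun c => WP.choose (pairWeight Γ E.W c j) (fun ω => putPair ω E)
        (Finset.univ : Finset (World L (Fin 2))).toList)
      (Finset.univ : Finset (Cell L)).toList g s
  else g s

/-- The element `E.var 0` gets the cell `j`. -/
def branchCmd [L.IsRelational] (Γ : L.Sentence) (j : Cell L) (E : Env L) : WP L := fun g =>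
  putCell j E fun s =>
    WP.forList (List.range E.n) (fun b => pairCmd Γ j (E.push 1 b)) g
      ((s.setCell (E.var 0) j).setCount j (s.count j + 1))

/-- The weight of the cell `j` for the element `a`. -/
def firstWeight [L.IsRelational] (Γ : L.Sentence) (W : Weighting L) (a : ℕ) (j : Cell L) : ℝ≥0 :=
  (if a < 1 then nullWeight W j else 1) * cellWeight Γ W j

/-- Sample the cell of the element `E.var 0`. -/
def elemCmd [L.IsRelational] (Γ : L.Sentence) (E : Env L) : WP L := fun g s =>
  WP.choose (fun j => firstWeight Γ E.W (E.var 0) j * stepWeight Γ E.W E.n s.tab s.count j)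
    (fun j => branchCmd Γ j E) (Finset.univ : Finset (Cell L)).toList g s

/-- The sampler. -/
def sampler [L.IsRelational] (Γ : L.Sentence) (E : Env L) : WP L := fun g =>
  fillCmd E (tableCmd Γ E
    (WP.forList (List.range E.n) (fun a => elemCmd Γ (E.push 0 a)) g))

/-! ### The sampler runs in polynomial time -/

/-- The condition involves neither the input nor the memory, so it is decided when the program is
written. This is how facts such as "this two-element world is a model of `Γ`" are hard-wired. -/
theorem IsReal.ite_const {d : ℕ} {e₁ e₂ : Env L → Mem L → ℝ≥0} (p : Prop) [Decidable p]
    (h₁ : IsReal d e₁) (h₂ : IsReal d e₂) :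
    IsReal d (fun E s => if p then e₁ E s else e₂ E s) := by
  by_cases hp : p <;> simpa [hp]

theorem IsReal.lit (d : ℕ) (P : Predicate L) (b : Bool) : IsReal d (fun E _ => E.W.lit P b) :=
  IsReal.ite_const _ (.pos d P) (.neg d P)

theorem IsReal.list_sum {d : ℕ} {ι : Type*} {f : ι → Env L → Mem L → ℝ≥0}
    (h : ∀ i, IsReal d (f i)) (l : List ι) : IsReal d (fun E s => (l.map (f · E s)).sum) := by
  induction l with
  | nil => exact .zero d
  | cons a l ih => simpa using (h a).add ih

theorem IsReal.nullWeight (d : ℕ) (j : Cell L) : IsReal d (fun E _ => nullWeight E.W j) :=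
  .prod _ fun P _ => .ite_const _ (.lit d P _) (.one d)

theorem IsReal.cellWeight [L.IsRelational] (Γ : L.Sentence) (d : ℕ) (j : Cell L) :
    IsReal d (fun E _ => cellWeight Γ E.W j) := by
  classical
  exact .ite_const _ (.prod _ fun P _ => .ite_const _ (.one d) (.lit d P _)) (.zero d)

theorem IsReal.pairWeight [L.IsRelational] (Γ : L.Sentence) (d : ℕ) (c j : Cell L)
    (ω : World L (Fin 2)) : IsReal d (fun E _ => pairWeight Γ E.W c j ω) := by
  classical
  exact .ite_const _ (.prod _ fun α _ => .ite_const _ (.lit d α.1 _) (.one d)) (.zero d)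

theorem IsNat.index {d : ℕ} {κ : Cell L → Env L → Mem L → ℕ} (h : ∀ c, IsNat d (κ c)) :
    IsNat d (fun E s => index E.n (κ · E s)) :=
  .sum _ fun c _ => (h c).mul_dom_pow _

theorem IsReal.stepWeight [L.IsRelational] (Γ : L.Sentence) {d : ℕ}
    {κ : Cell L → Env L → Mem L → ℕ} (h : ∀ c, IsNat d (κ c)) (j : Cell L) :
    IsReal d (fun E s => stepWeight Γ E.W E.n s.tab (κ · E s) j) := by
  have h' : ∀ c, IsNat d (fun E s => incr (κ · E s) j c) := fun c => (h c).add (.const d _)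
  refine .mul (.prod _ fun c _ => .pow_min (.sum _ fun ω _ => .pairWeight Γ d c j ω) (h c)) ?_
  exact .ite_lt (.sum _ fun c _ => h' c) (.dom d) (.tab (.index h')) (.one d)

namespace IsCmd

variable {d : ℕ}

theorem choose {α : Type*} {w : α → Env L → Mem L → ℝ≥0} {c : α → Env L → WP L}
    (hw : ∀ a, IsReal d (w a)) (hc : ∀ a, IsCmd d (c a)) (l : List α) :
    IsCmd d (fun E g s => WP.choose (w · E s) (c · E) l g s) := by
  induction l with
  | nil => exact skip d
  | cons a l ih => exact flip (.div (hw a) (.add (hw a) (.list_sum hw l))) (hc a) ih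

theorem switch_cell {k : Env L → Mem L → ℕ} {c : Cell L → Env L → WP L} (hk : IsNat d k)
    (hc : ∀ a, IsCmd d (c a)) (l : List (Cell L)) :
    IsCmd d (fun E g s => WP.switch (fun a s => s.cell (k E s) = a) (c · E) l g s) := by
  induction l with
  | nil => exact skip d
  | cons a l ih =>
    have := ite_cell hk a (hc a) ih
    refine cast (congrArg _ ?_) this
    funext E g s
    simp only [WP.switch]

/-- The nesting depth `q` does not depend on the input: it is an arity or the number of cells. The
bound is thus a polynomial in `n`, of a degree that grows with `q`. -/
theorem forVars {c : Env L → WP L} {d q : ℕ} (h : IsCmd (d + q) c) :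
    IsCmd d (WP.forVars c d q) := by
  induction q generalizing d with
  | zero => exact h
  | succ q ih => exact loop (ih (by rwa [add_right_comm]))

theorem fill : IsCmd (L := L) 0 fillCmd :=
  forList _ fun P _ => forVars (flip (.div (.pos _ P) (.add (.pos _ P) (.neg _ P)))
    (put P _ (fun i => by omega) true) (put P _ (fun i => by omega) false))

theorem table [L.IsRelational] (Γ : L.Sentence) : IsCmd 0 (tableCmd Γ) := by
  have hκ : ∀ c : Cell L, IsNat (L := L) (1 + Fintype.card (Cell L))
      (fun E _ => E.var (1 + enc c)) := fun c => .var (by omega)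
  refine loop (c := sweepCmd Γ 1) ?_
  rw [zero_add]
  exact (forVars (setTab (.index hκ)
    (.sum _ fun j _ => .mul (.cellWeight Γ _ j) (.stepWeight Γ hκ j))))

theorem putCell (j : Cell L) : IsCmd 1 (putCell j) := by
  refine forList _ fun P _ => ?_
  by_cases hP : P.1 = 0
  · simp only [hP, if_true]
    exact ite_lt (.var one_pos) (.const 1 1) (put P (fun _ => 0) (fun _ => one_pos) _) (skip 1)
  · simp only [hP, if_false]
    exact put P (fun _ => 0) (fun _ => one_pos) _

theorem putPair (ω : World L (Fin 2)) : IsCmd 2 (putPair ω) := by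
  classical
  refine forList _ fun α _ => ?_
  by_cases hα : IsMixed α
  · simp only [hα, if_true]
    exact put α.1 _ (fun i => by split_ifs <;> omega) _
  · simp only [hα, if_false]
    exact skip 2

theorem pair [L.IsRelational] (Γ : L.Sentence) (j : Cell L) : IsCmd 2 (pairCmd Γ j) :=
  ite_lt (.var (by omega)) (.var (by omega))
    (switch_cell (.var (by omega))
      (fun c => choose (fun ω => .pairWeight Γ 2 c j ω) (fun ω => putPair ω) _) _) (skip 2)

theorem branch [L.IsRelational] (Γ : L.Sentence) (j : Cell L) : IsCmd 1 (branchCmd Γ j) :=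
  seq (c₁ := WFOMS.putCell j) (putCell j) (seq (setCell (.var one_pos) j)
    (seq (setCount j ((IsNat.count 1 j).add (.const 1 1))) (loop (pair Γ j))))

theorem elem [L.IsRelational] (Γ : L.Sentence) : IsCmd 1 (elemCmd Γ) :=
  choose (fun j => .mul (.mul (.ite_lt (.var one_pos) (.const 1 1) (.nullWeight 1 j) (.one 1))
    (.cellWeight Γ 1 j)) (.stepWeight Γ (.count 1) j)) (fun j => branch Γ j) _

theorem sampler [L.IsRelational] (Γ : L.Sentence) : IsCmd 0 (sampler Γ) :=
  seq (c₁ := fillCmd) fill (seq (c₁ := tableCmd Γ) (table Γ) (loop (elem Γ)))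

end IsCmd

/-! ### From the sampler to the machine -/

/-- The memory at the start. -/
def Mem.init (L : FirstOrder.Language.{u, v}) [Fintype (Predicate L)] : Mem L where
  count := fun _ => 0
  tab := fun _ => 0
  cell := fun _ => enc.symm ⟨0, card_cell_pos⟩
  out := fun _ => false

/-- The structure over the domain `{0, …, n-1}` that is stored in the output. -/
def Mem.world (s : Mem L) (n : ℕ) : World L (Fin n) := s.out.pull (fun i : Fin n => (i : ℕ))

omit [Fintype (Predicate L)] in
theorem run_nil (W : Weighting L) (t : ℕ) (σ : State L) : run W t ⟨[], σ⟩ = PMF.pure ⟨[], σ⟩ := by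
  induction t with
  | zero => rfl
  | succ t ih => rw [run, step, PMF.pure_bind, ih]

theorem Rel.init (E : Env L) (p : Prog L) :
    Rel 0 E (Mem.init L) (start p E.n).state where
  dom := by simp [start]
  count c := by simp [start, Mem.init]
  var e he := by omega
  tab i := by simp [start, Mem.init]
  cell i := by simp [start, Mem.init]
  out := rfl

/-- A command that, up to a constant, outputs the models of `Γ` with their weights is
a sampler. -/
theorem IsCmd.samplingLiftable [L.IsRelational] {Γ : L.Sentence} {c : Env L → WP L}
    (hc : IsCmd 0 c)
    (h : ∀ E : Env L, ∃ Z : ℝ≥0, ∀ μ : World L (Fin E.n), open Classical in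
      Z * c E (fun s => if s.world E.n = μ then 1 else 0) (Mem.init L)
        = if μ.Models Γ then (E.W.weight μ : ℝ≥0∞) else 0) : SamplingLiftable Γ := by
  classical
  obtain ⟨p, T, hp⟩ := hc
  refine ⟨p, T, fun W n => ?_, fun W n hn μ => ?_⟩
  · have hrel := Rel.init ⟨W, n, fun _ => 0⟩ p
    set E : Env L := ⟨W, n, fun _ => 0⟩
    -- Halting is read off from the simulation itself. The zero postcondition has expectation zero,
    -- and after `T` steps it may be compared with the indicator of not having halted, as both
    -- vanish on halted configurations.
    have h0 : c E (fun _ => 0) (Mem.init L) = 0 := by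
      rw [← hp E [] 0 (fun _ => 0) (fun _ => 0) (by simp [expect]) _ _ hrel (T.eval E.n) (by simp)]
      simp [expect]
    have h1 := hp E [] 0 (fun c => if c.todo = [] then 0 else 1) (fun _ => 0) (by
      intro s σ _ t _
      simp [run_nil, expect_pure]) _ _ hrel (T.eval E.n) (by simp)
    rw [h0, expect, ENNReal.tsum_eq_zero] at h1
    intro cf hcf
    by_contra hne
    have := h1 cf
    simp only [hne, if_false, mul_one] at this
    exact ((PMF.mem_support_iff _ _).1 hcf) this
  · have hrel := Rel.init ⟨W, n, fun _ => 0⟩ p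
    set E : Env L := ⟨W, n, fun _ => 0⟩ with hE
    obtain ⟨Z, hZ⟩ := h E
    have h1 : ∀ μ : World L (Fin n), ((run W (T.eval n) (start p n)).map (Config.output n)) μ
        = c E (fun s => if s.world E.n = μ then 1 else 0) (Mem.init L) := by
      intro μ
      rw [← hp E [] 0 (fun c => if c.output n = μ then 1 else 0) _ (by
        intro s σ hs t _
        have : Config.output n ⟨[], σ⟩ = s.world E.n := by
          funext a
          exact congrFun hs.out _
        rw [run_nil, expect_pure, this]) _ _ hrel (T.eval E.n) (by simp)]
      rw [PMF.map_apply, expect]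
      refine tsum_congr fun a => ?_
      simp [eq_comm, hE, start]
    -- Summing the hypothesis over all `μ` identifies `Z`, because the probabilities on the left add
    -- up to one.
    have hsum : (Z : ℝ≥0∞) = WFOMC Γ n W := by
      have h2 : ∑ μ : World L (Fin n),
          ((run W (T.eval n) (start p n)).map (Config.output n)) μ = 1 := by
        rw [← tsum_fintype (L := .unconditional _)]; exact PMF.tsum_coe _
      rw [← mul_one (Z : ℝ≥0∞), ← h2, Finset.mul_sum, WFOMC, ENNReal.ofNNReal_finsetSum]
      refine Finset.sum_congr rfl fun μ _ => ?_
      rw [h1, hZ]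
      split_ifs <;> rfl
    have hZn : Z = WFOMC Γ n W := by exact_mod_cast hsum
    have := hZ μ
    rw [hZn] at this
    rw [h1 μ]
    have hn' : ((WFOMC Γ n W : ℝ≥0) : ℝ≥0∞) ≠ 0 := by exact_mod_cast hn
    split_ifs with hμ
    · rw [if_pos hμ] at this
      rw [ENNReal.coe_div hn, ENNReal.eq_div_iff hn' ENNReal.coe_ne_top, this]
    · rw [if_neg hμ] at this
      exact (mul_eq_zero.1 this).resolve_left hn'

end Sampler

/-! ### Expectations of the commands: choices, free atoms and the table -/

section Semantics

variable {L : FirstOrder.Language.{u, v}}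

/-! ### Semantics of the commands -/

/-- Multiplying by `a + b` removes the quotient. If `a + b = 0`, both sides are zero whatever the
coin does. -/
theorem WP.flip_spec (a b : ℝ≥0) (c₁ c₂ : WP L) (g : Mem L → ℝ≥0∞) (s : Mem L) :
    ((a + b : ℝ≥0) : ℝ≥0∞) * WP.flip (a / (a + b)) c₁ c₂ g s = a * c₁ g s + b * c₂ g s := by
  by_cases h : a + b = 0
  · obtain ⟨rfl, rfl⟩ : a = 0 ∧ b = 0 := by simpa using h
    simp
  · have h1 : a / (a + b) ≤ 1 := div_le_one_of_le₀ (by simp) (by simp)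
    have h2 : 1 - a / (a + b) = b / (a + b) := by
      rw [tsub_eq_iff_eq_add_of_le h1]
      field_simp
      ring
    rw [WP.flip, min_eq_left h1, h2, mul_add, ← mul_assoc, ← mul_assoc, ← ENNReal.coe_mul,
      ← ENNReal.coe_mul, mul_div_cancel₀ _ h, mul_div_cancel₀ _ h]

/-- The bias is irrelevant when both outcomes lead to the same value. -/
theorem WP.flip_eq {x : ℝ≥0} {c₁ c₂ : WP L} {g : Mem L → ℝ≥0∞} {s : Mem L} {y z : ℝ≥0∞}
    (h₁ : y * c₁ g s = z) (h₂ : y * c₂ g s = z) : y * WP.flip x c₁ c₂ g s = z := by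
  rw [WP.flip, mul_add, mul_left_comm, mul_left_comm y, h₁, h₂, ← add_mul, ← ENNReal.coe_add,
    add_tsub_cancel_of_le (min_le_right _ _), ENNReal.coe_one, one_mul]

/-- The conditional probabilities telescope: each denominator in `WP.choose` is the weight of the
remaining list, which the induction hypothesis cancels. -/
theorem WP.choose_spec {α : Type*} (w : α → ℝ≥0) (c : α → WP L) (l : List α)
    (g : Mem L → ℝ≥0∞) (s : Mem L) :
    (((l.map w).sum : ℝ≥0) : ℝ≥0∞) * WP.choose w c l g s = (l.map fun a => w a * c a g s).sum := by
  induction l with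
  | nil => simp
  | cons a l ih => rw [List.map_cons, List.sum_cons, WP.choose, WP.flip_spec, ih]; simp

theorem WP.choose_univ {α : Type*} [Fintype α] (w : α → ℝ≥0) (c : α → WP L)
    (g : Mem L → ℝ≥0∞) (s : Mem L) :
    ((∑ a, w a : ℝ≥0) : ℝ≥0∞) * WP.choose w c (Finset.univ : Finset α).toList g s
      = ∑ a, w a * c a g s := by
  simpa [Finset.sum_map_toList] using WP.choose_spec w c (Finset.univ : Finset α).toList g s

theorem WP.switch_eq {α : Type*} {p : α → Mem L → Prop} (c : α → WP L) {l : List α}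
    (g : Mem L → ℝ≥0∞) {s : Mem L} {a : α} (ha : a ∈ l) (hp : ∀ b, p b s ↔ b = a) :
    WP.switch p c l g s = c a g s := by
  induction l with
  | nil => simp at ha
  | cons b l ih =>
    simp only [WP.switch]
    by_cases h : b = a
    · subst h
      simp [(hp b).2 rfl]
    · rw [if_neg (mt (hp b).1 h)]
      exact ih ((List.mem_cons.1 ha).resolve_left (Ne.symm h))

theorem WP.forList_append {α : Type*} (l l' : List α) (c : α → WP L) (g : Mem L → ℝ≥0∞) :
    WP.forList (l ++ l') c g = WP.forList l c (WP.forList l' c g) := by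
  simp [WP.forList]

theorem WP.forList_map {α β : Type*} (l : List α) (f : α → β) (c : β → WP L) :
    WP.forList (l.map f) c = WP.forList l (fun a => c (f a)) := by
  funext g
  simp [WP.forList, List.foldr_map]

theorem WP.forList_flatMap {α β : Type*} (l : List α) (f : α → List β) (c : β → WP L) :
    WP.forList (l.flatMap f) c = WP.forList l (fun a => WP.forList (f a) c) := by
  funext g
  induction l with
  | nil => rfl
  | cons a l ih => rw [List.flatMap_cons, WP.forList_append, ih]; rfl

theorem WP.forList_congr {α : Type*} {l : List α} {c c' : α → WP L} (h : ∀ a ∈ l, c a = c' a) :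
    WP.forList l c = WP.forList l c' := by
  funext g
  induction l with
  | nil => rfl
  | cons a l ih =>
    have := ih fun b hb => h b (by simp [hb])
    simp only [WP.forList, List.foldr_cons] at this ⊢
    rw [this, h a (by simp)]

/-- Backward induction along a loop. -/
theorem WP.forList_range_induction {n : ℕ} {c : ℕ → WP L} (Q : ℕ → (Mem L → ℝ≥0∞) → Prop)
    (h : ∀ a < n, ∀ g, Q (a + 1) g → Q a (c a g)) {g : Mem L → ℝ≥0∞} (hg : Q n g) :
    Q 0 (WP.forList (List.range n) c g) := by
  induction n generalizing g with
  | zero => exact hg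
  | succ n ih =>
    rw [List.range_succ, WP.forList_append]
    exact ih (fun a ha => h a (by omega)) (h n (by omega) g hg)

theorem WP.forList_det {α : Type*} {l : List α} {c : α → WP L} (F : α → Mem L → Mem L)
    (h : ∀ a ∈ l, ∀ g s, c a g s = g (F a s)) (g : Mem L → ℝ≥0∞) (s : Mem L) :
    WP.forList l c g s = g (l.foldl (fun s a => F a s) s) := by
  induction l generalizing s with
  | nil => rfl
  | cons a l ih =>
    exact (h a (by simp) _ s).trans (ih (fun b hb => h b (by simp [hb])) _)

open Classical in
/-- Output the values that `y` gives to the atoms in `Y`. -/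
def Mem.write (s : Mem L) (Y : Set (GroundAtom L ℕ)) (y : World L ℕ) : Mem L :=
  { s with out := fun α => if α ∈ Y then y α else s.out α }

theorem Mem.put_eq_write (s : Mem L) (α : GroundAtom L ℕ) (y : World L ℕ) :
    s.put α (y α) = s.write {α} y := by
  simp only [Mem.put, Mem.write]
  congr 1
  funext β
  by_cases h : β = α <;> simp [h]

theorem Mem.write_empty (s : Mem L) (y : World L ℕ) : s.write ∅ y = s := by
  simp [Mem.write]

theorem Mem.write_write (s : Mem L) (Y Y' : Set (GroundAtom L ℕ)) (y : World L ℕ) :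
    (s.write Y y).write Y' y = s.write (Y ∪ Y') y := by
  simp only [Mem.write]
  congr 1
  funext β
  by_cases h : β ∈ Y <;> by_cases h' : β ∈ Y' <;> simp [h, h']

/-- All writes take their values from the same world `y`, so order and overlaps do not matter and
only the union of the written sets counts. -/
theorem WP.forList_write {α : Type*} {l : List α} {c : α → WP L}
    (Y : α → Set (GroundAtom L ℕ)) (y : World L ℕ)
    (h : ∀ a ∈ l, ∀ g s, c a g s = g (s.write (Y a) y)) (g : Mem L → ℝ≥0∞) (s : Mem L) :
    WP.forList l c g s = g (s.write (⋃ a ∈ l, Y a) y) := by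
  induction l generalizing s with
  | nil => simp [WP.forList, Mem.write_empty]
  | cons a l ih =>
    have := ih (fun b hb => h b (by simp [hb])) (s.write (Y a) y)
    rw [Mem.write_write] at this
    have hu : (⋃ b ∈ a :: l, Y b) = Y a ∪ ⋃ b ∈ l, Y b := by
      ext; simp
    rw [hu, ← this]
    exact h a (by simp) _ s

/-! ### Nested loops -/

/-- The environments in which the body of `WP.forVars` is run. -/
def Env.tuples : ℕ → ℕ → Env L → List (Env L)
  | _, 0, E => [E]
  | d, q + 1, E => (List.range E.n).flatMap fun t => Env.tuples (d + 1) q (E.push d t)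

theorem WP.forVars_eq (c : Env L → WP L) (d q : ℕ) (E : Env L) :
    WP.forVars c d q E = WP.forList (E.tuples d q) c := by
  induction q generalizing d E with
  | zero => rfl
  | succ q ih => simp only [WP.forVars, Env.tuples, WP.forList_flatMap, ih]

theorem Env.mem_tuples {d q : ℕ} {E E' : Env L} :
    E' ∈ E.tuples d q ↔ E'.W = E.W ∧ E'.n = E.n ∧
      (∀ i, i < d ∨ d + q ≤ i → E'.var i = E.var i) ∧
      ∀ i, d ≤ i → i < d + q → E'.var i < E.n := by
  induction q generalizing d E with
  | zero =>
    simp only [Env.tuples, List.mem_singleton]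
    constructor
    · rintro rfl
      exact ⟨rfl, rfl, fun _ _ => rfl, fun i h h' => by omega⟩
    · rintro ⟨h1, h2, h3, -⟩
      cases E; cases E'
      simp only at h1 h2 h3
      subst h1 h2
      congr 1
      funext i
      exact h3 i (by omega)
  | succ q ih =>
    simp only [Env.tuples, List.mem_flatMap, List.mem_range, ih, Env.push_W, Env.push_n]
    constructor
    · rintro ⟨t, ht, h1, h2, h3, h4⟩
      refine ⟨h1, h2, fun i hi => ?_, fun i hi hi' => ?_⟩
      · rw [h3 i (by omega), E.push_var_of_ne t (by omega)]
      · rcases hi.eq_or_lt with rfl | hlt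
        · rw [h3 _ (by omega), E.push_var_self]; exact ht
        · exact h4 i hlt (by omega)
    · rintro ⟨h1, h2, h3, h4⟩
      refine ⟨E'.var d, h4 d le_rfl (by omega), h1, h2, fun i hi => ?_, fun i hi hi' =>
        h4 i (by omega) (by omega)⟩
      by_cases hd : i = d
      · subst hd; simp
      · rw [E.push_var_of_ne _ hd, h3 i (by omega)]

theorem Env.nodup_tuples (d q : ℕ) (E : Env L) : (E.tuples d q).Nodup := by
  induction q generalizing d E with
  | zero => simp [Env.tuples]
  | succ q ih =>
    rw [Env.tuples, List.nodup_flatMap]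
    refine ⟨fun t _ => ih _ _, List.Pairwise.imp ?_ List.nodup_range⟩
    intro t t' htt' E' h h'
    have e1 := (Env.mem_tuples.1 h).2.2.1 d (by omega)
    have e2 := (Env.mem_tuples.1 h').2.2.1 d (by omega)
    rw [Env.push_var_self] at e1 e2
    exact htt' (e1.symm.trans e2)

/-! ### The coins for all atoms -/

/-- Toss a coin for the ground atom `α`. -/
def flipAtom (W : Weighting L) (α : GroundAtom L ℕ) : WP L :=
  WP.flip (W.pos α.1 / (W.pos α.1 + W.neg α.1)) (fun g s => g (s.put α true))
    (fun g s => g (s.put α false))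

theorem exists_fillCmd_eq [Fintype (Predicate L)] (E : Env L) : ∃ l : List (GroundAtom L ℕ),
    l.Nodup ∧ (∀ α, α ∈ l ↔ ∀ i, α.2 i < E.n) ∧
      fillCmd E = WP.forList l (flipAtom E.W) := by
  classical
  refine ⟨(Finset.univ : Finset (Predicate L)).toList.flatMap fun P =>
    (E.tuples 0 P.1).map fun E' => (⟨P, fun i => E'.var i⟩ : GroundAtom L ℕ), ?_, ?_, ?_⟩
  · rw [List.nodup_flatMap]
    refine ⟨fun P _ => List.Nodup.map_on ?_ (Env.nodup_tuples _ _ _),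
      List.Pairwise.imp ?_ (Finset.nodup_toList _)⟩
    · intro E₁ h₁ E₂ h₂ h
      rw [Env.mem_tuples] at h₁ h₂
      simp only [Sigma.mk.injEq, heq_eq_eq, true_and] at h
      obtain ⟨W₁, n₁, v₁⟩ := E₁
      obtain ⟨W₂, n₂, v₂⟩ := E₂
      simp only at h₁ h₂ h
      obtain ⟨rfl, rfl, h₁, -⟩ := h₁
      obtain ⟨rfl, rfl, h₂, -⟩ := h₂
      congr 1
      funext i
      by_cases hi : i < P.1
      · exact congrFun h ⟨i, hi⟩
      · rw [h₁ i (by omega), h₂ i (by omega)]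
    · intro P P' hne α h h'
      simp only [List.mem_map] at h h'
      obtain ⟨_, _, rfl⟩ := h
      obtain ⟨_, _, h⟩ := h'
      exact hne (congrArg Sigma.fst h).symm
  · rintro ⟨P, a⟩
    simp only [List.mem_flatMap, Finset.mem_toList, Finset.mem_univ, true_and, List.mem_map,
      Env.mem_tuples]
    constructor
    · rintro ⟨P', E', ⟨-, -, -, h⟩, heq⟩ i
      cases heq
      exact h i (by omega) (by omega)
    · intro h
      refine ⟨P, { E with var := fun i => if hi : i < P.1 then a ⟨i, hi⟩ else E.var i },
        ⟨rfl, rfl, fun i hi => ?_, fun i _ hi => ?_⟩, ?_⟩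
      · simp [show ¬ i < P.1 by omega]
      · have hi' : i < P.1 := by omega
        simpa [hi'] using h ⟨i, hi'⟩
      · simp
  · rw [WP.forList_flatMap]
    refine WP.forList_congr fun P _ => ?_
    rw [WP.forVars_eq, WP.forList_map]
    refine WP.forList_congr fun E' hE' => ?_
    rw [(Env.mem_tuples.1 hE').1]
    rfl

/-- The output agrees with `m` on `Y`. -/
def Agree (m : World L ℕ) (Y : Set (GroundAtom L ℕ)) (s : Mem L) : Prop :=
  ∀ α ∈ Y, s.out α = m α

-- `X` will be the set of atoms that are never overwritten later. A coin for an atom of `X`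
-- contributes the constant `w + w̄` and, if it shows the value in `m`, the weight of that literal;
-- a coin for any other atom is invisible to the postcondition. While `l` remains to be tossed,
-- agreement can be demanded only on the atoms of `X` outside `l`.
open Classical in
theorem forList_flipAtom (W : Weighting L) (m : World L ℕ) (X : Set (GroundAtom L ℕ))
    (A D : ℝ≥0∞) (κ : Cell L → ℕ) (tab : ℕ → ℝ≥0) (g : Mem L → ℝ≥0∞)
    (hg : ∀ s : Mem L, s.count = κ → s.tab = tab → A * g s = if Agree m X s then D else 0)
    {l : List (GroundAtom L ℕ)} (hl : l.Nodup) (s : Mem L) (hs : s.count = κ)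
    (ht : s.tab = tab) :
    (((l.map fun α => if α ∈ X then W.pos α.1 + W.neg α.1 else 1).prod : ℝ≥0) : ℝ≥0∞) * A
        * WP.forList l (flipAtom W) g s
      = if Agree m {α ∈ X | α ∉ l} s then
          (((l.map fun α => if α ∈ X then W.lit α.1 (m α) else 1).prod : ℝ≥0) : ℝ≥0∞) * D
        else 0 := by
  induction l generalizing s with
  | nil => simpa [WP.forList] using hg s hs ht
  | cons α l ih =>
    obtain ⟨hα, hl⟩ := List.nodup_cons.1 hl
    have ih' : ∀ b, _ := fun b => ih hl (s.put α b) hs ht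
    have hf : WP.forList (α :: l) (flipAtom W) g s
        = flipAtom W α (WP.forList l (flipAtom W) g) s := rfl
    rw [hf, List.map_cons, List.map_cons, List.prod_cons, List.prod_cons]
    set h := WP.forList l (flipAtom W) g
    set R := (l.map fun α => if α ∈ X then W.pos α.1 + W.neg α.1 else 1).prod
    set R' := (l.map fun α => if α ∈ X then W.lit α.1 (m α) else 1).prod
    by_cases hX : α ∈ X
    · have hag : ∀ b, Agree m {β ∈ X | β ∉ l} (s.put α b) ↔
          b = m α ∧ Agree m {β ∈ X | β ∉ α :: l} s := by
        intro b
        constructor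
        · intro H
          refine ⟨by simpa [Mem.put] using H α ⟨hX, hα⟩, fun β ⟨hβ, hβl⟩ => ?_⟩
          rw [List.mem_cons, not_or] at hβl
          simpa [Mem.put, hβl.1] using H β ⟨hβ, hβl.2⟩
        · rintro ⟨rfl, H⟩ β ⟨hβ, hβl⟩
          by_cases hβα : β = α
          · simp [Mem.put, hβα]
          · simpa [Mem.put, hβα] using H β ⟨hβ, by simp [hβα, hβl]⟩
      rw [if_pos hX, if_pos hX, ENNReal.coe_mul, mul_comm _ (R : ℝ≥0∞), mul_assoc, mul_assoc,
        mul_left_comm _ A, ← mul_assoc, flipAtom, WP.flip_spec, mul_add, mul_left_comm,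
        mul_left_comm _ (W.neg α.1 : ℝ≥0∞), ih' true, ih' false]
      simp only [hag, Weighting.lit]
      cases hm : m α <;> by_cases hA : Agree m {β ∈ X | β ∉ α :: l} s <;>
        simp [mul_assoc]
    · have hag : ∀ b, Agree m {β ∈ X | β ∉ l} (s.put α b) ↔
          Agree m {β ∈ X | β ∉ α :: l} s := by
        intro b
        have hne : ∀ β ∈ X, β ≠ α := fun β hβ h => hX (h ▸ hβ)
        constructor
        · rintro H β ⟨hβ, hβl⟩
          simpa [Mem.put, hne β hβ] using H β ⟨hβ, fun h => hβl (by simp [h])⟩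
        · rintro H β ⟨hβ, hβl⟩
          simpa [Mem.put, hne β hβ] using H β ⟨hβ, by simp [hne β hβ, hβl]⟩
      rw [if_neg hX, if_neg hX, one_mul, one_mul]
      -- An atom outside `X` does not affect agreement on `X`, so the bias of its coin plays no
      -- role.
      refine WP.flip_eq ?_ ?_
      · simpa only [hag] using ih' true
      · simpa only [hag] using ih' false

/-! ### The table -/

section Table

variable [Fintype (Predicate L)]

/-- The index reads `κ` as the digits of a numeral in base `n`, which is why the entries must be
below `n`. -/
theorem index_injOn {n : ℕ} {κ κ' : Cell L → ℕ} (h : ∀ c, κ c < n) (h' : ∀ c, κ' c < n)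
    (heq : index n κ = index n κ') : κ = κ' := by
  have key : ∀ (κ : Cell L → ℕ) (h : ∀ c, κ c < n),
      index n κ = finFunctionFinEquiv (fun i => (⟨κ (enc.symm i), h _⟩ : Fin n)) := by
    intro κ h
    rw [finFunctionFinEquiv_apply, index, ← Equiv.sum_comp enc.symm]
    simp
  rw [key κ h, key κ' h'] at heq
  have := finFunctionFinEquiv.injective (Fin.ext heq)
  funext c
  simpa using congrArg Fin.val (congrFun this (enc c))

omit [Fintype (Predicate L)] in
theorem Cell.lt_of_sum_lt [Fintype (Cell L)] {n : ℕ} {κ : Cell L → ℕ} (h : ∑ c, κ c < n) (c : Cell L) : κ c < n :=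
  (Finset.single_le_sum (f := κ) (fun _ _ => Nat.zero_le _) (Finset.mem_univ c)).trans_lt h

theorem sum_incr (κ : Cell L → ℕ) (j : Cell L) : ∑ c, incr κ j c = ∑ c, κ c + 1 := by
  simp [incr, Finset.sum_add_distrib]

variable [L.IsRelational] (Γ : L.Sentence) (W : Weighting L)

/-- The total weight of the ways to add `m` elements to elements whose cells are counted
by `κ`. -/
def completion : ℕ → (Cell L → ℕ) → ℝ≥0
  | 0, _ => 1
  | m + 1, κ => ∑ j, cellWeight Γ W j *
      ((∏ c, linkWeight Γ W c j ^ κ c) * completion m (incr κ j))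

/-- The table entry of `κ` is right. -/
def IsRight (n : ℕ) (tab : ℕ → ℝ≥0) (κ : Cell L → ℕ) : Prop :=
  tab (index n κ) = completion Γ W (n - ∑ c, κ c) κ

variable {Γ W}

/-- One step of the recursion for `completion` uses only vectors with one more element. When the
enlarged vector has sum `n` it has no table entry, and the default 1 of `entry` is `completion` with
no elements left. -/
theorem stepWeight_eq {n : ℕ} {tab : ℕ → ℝ≥0} {κ : Cell L → ℕ} (hκ : ∑ c, κ c < n)
    (h : ∀ κ', ∑ c, κ c < ∑ c, κ' c → ∑ c, κ' c < n → IsRight Γ W n tab κ') :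
    ∑ j, cellWeight Γ W j * stepWeight Γ W n tab κ j = completion Γ W (n - ∑ c, κ c) κ := by
  obtain ⟨m, hm⟩ : ∃ m, n - ∑ c, κ c = m + 1 := ⟨n - ∑ c, κ c - 1, by omega⟩
  rw [hm, completion]
  refine Finset.sum_congr rfl fun j _ => ?_
  rw [stepWeight]
  congr 2
  · exact Finset.prod_congr rfl fun c _ => by rw [min_eq_left (Cell.lt_of_sum_lt hκ c).le]
  · have hs := sum_incr κ j
    rw [entry]
    split_ifs with hlt
    · rw [h _ (by omega) hlt]
      congr 1
      omega
    · rw [show m = 0 by omega, completion]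

/-- Recomputing an entry at a level at least `lo` makes it right, since the levels above are right
already. Writing any other entry, including meaningless ones for vectors with sum at least `n`, does
no harm because `index` is injective. -/
theorem IsRight.update {n lo : ℕ} {s : Mem L} {κ κ' : Cell L → ℕ}
    (h : ∀ κ, lo < ∑ c, κ c → ∑ c, κ c < n → IsRight Γ W n s.tab κ) (hκ : ∀ c, κ c < n)
    (h' : lo ≤ ∑ c, κ' c) (hn : ∑ c, κ' c < n) (hκ' : κ' = κ ∨ IsRight Γ W n s.tab κ') :
    IsRight Γ W n (s.setTab (index n κ)
      (∑ j, cellWeight Γ W j * stepWeight Γ W n s.tab κ j)).tab κ' := by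
  by_cases heq : κ' = κ
  · subst heq
    simp only [IsRight, Mem.setTab, if_true]
    exact stepWeight_eq hn fun κ'' h1 h2 => h κ'' (by omega) h2
  · have hne : index n κ' ≠ index n κ := fun hi =>
      heq (index_injOn (Cell.lt_of_sum_lt hn) hκ hi)
    simpa [IsRight, Mem.setTab, hne] using hκ'.resolve_left heq

/-- A sweep visits the vectors in an order unrelated to their sums, so it is only claimed to gain
one level: right above `lo` before, right from `lo` on after. -/
theorem exists_sweepCmd_eq (E : Env L) (d lo : ℕ) (s : Mem L)
    (h : ∀ κ, lo < ∑ c, κ c → ∑ c, κ c < E.n → IsRight Γ E.W E.n s.tab κ) :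
    ∃ tab, (∀ g, sweepCmd Γ d E g s = g { s with tab := tab }) ∧
      ∀ κ, lo ≤ ∑ c, κ c → ∑ c, κ c < E.n → IsRight Γ E.W E.n tab κ := by
  let vec : Env L → Cell L → ℕ := fun E' c => E'.var (d + enc c)
  let F : Env L → Mem L → Mem L := fun E' s => s.setTab (index E.n (vec E'))
    (∑ j, cellWeight Γ E.W j * stepWeight Γ E.W E.n s.tab (vec E') j)
  -- Along the sweep, every vector of level at least `lo` is either still to be visited or already
  -- right.
  have key : ∀ l : List (Env L), (∀ E' ∈ l, ∀ c, vec E' c < E.n) → ∀ s : Mem L,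
      (∀ κ, lo < ∑ c, κ c → ∑ c, κ c < E.n → IsRight Γ E.W E.n s.tab κ) →
      ∃ tab, l.foldl (fun s E' => F E' s) s = { s with tab := tab } ∧
        ∀ κ, lo ≤ ∑ c, κ c → ∑ c, κ c < E.n →
          ((∃ E' ∈ l, κ = vec E') ∨ IsRight Γ E.W E.n s.tab κ) → IsRight Γ E.W E.n tab κ := by
    intro l
    induction l with
    | nil => exact fun _ s _ => ⟨s.tab, rfl, fun κ _ _ hκ => by simpa using hκ⟩
    | cons E' l ih =>
      intro hl s hs
      have hE' := hl E' (by simp)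
      obtain ⟨tab, h1, h2⟩ := ih (fun E'' hE'' => hl E'' (by simp [hE''])) (F E' s)
        (fun κ hκ hn => IsRight.update hs hE' hκ.le hn (.inr (hs κ hκ hn)))
      refine ⟨tab, h1, fun κ hκ hn h => h2 κ hκ hn ?_⟩
      rcases h with ⟨E'', hE'', rfl⟩ | h
      · rcases List.mem_cons.1 hE'' with rfl | hE''
        · exact .inr (IsRight.update hs hE' hκ hn (.inl rfl))
        · exact .inl ⟨E'', hE'', rfl⟩
      · exact .inr (IsRight.update hs hE' hκ hn (.inr h))
  obtain ⟨tab, h1, h2⟩ := key (E.tuples d (Fintype.card (Cell L)))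
    (fun E' hE' c => (Env.mem_tuples.1 hE').2.2.2 _ (by omega) (by omega)) s h
  refine ⟨tab, fun g => ?_, fun κ hκ hn => h2 κ hκ hn (.inl ?_)⟩
  · rw [sweepCmd, WP.forVars_eq, WP.forList_det F, h1]
    intro E' hE' g s
    simp only [F, vec, (Env.mem_tuples.1 hE').1, (Env.mem_tuples.1 hE').2.1]
  · let f : ℕ → ℕ := fun i => if hi : d ≤ i ∧ i < d + Fintype.card (Cell L) then
      κ (enc.symm ⟨i - d, by omega⟩) else E.var i
    refine ⟨{ E with var := f }, Env.mem_tuples.2 ⟨rfl, rfl, fun i hi => ?_,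
        fun i hi hi' => ?_⟩, ?_⟩
    · simp only [f]
      rw [dif_neg (by omega)]
    · simp only [f]
      rw [dif_pos ⟨hi, hi'⟩]
      exact Cell.lt_of_sum_lt hn _
    · funext c
      simp only [vec, f]
      rw [dif_pos ⟨by omega, by omega⟩]
      simp

/-- After `t` sweeps all vectors with sum at least `n - t` are right, whatever the table contained
at first; `n` sweeps reach the zero vector. -/
theorem exists_tableCmd_eq (E : Env L) (s : Mem L) :
    ∃ tab, (∀ g, tableCmd Γ E g s = g { s with tab := tab }) ∧
      ∀ κ, ∑ c, κ c < E.n → IsRight Γ E.W E.n tab κ := by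
  have key : ∀ n : ℕ, ∃ tab, (∀ g, WP.forList (List.range n)
      (fun t => sweepCmd Γ 1 (E.push 0 t)) g s = g { s with tab := tab }) ∧
      ∀ κ, E.n ≤ ∑ c, κ c + n → ∑ c, κ c < E.n → IsRight Γ E.W E.n tab κ := by
    intro n
    induction n with
    | zero => exact ⟨s.tab, fun g => rfl, fun κ h h' => by omega⟩
    | succ n ih =>
      obtain ⟨tab, h1, h2⟩ := ih
      obtain ⟨tab', h3, h4⟩ := exists_sweepCmd_eq (Γ := Γ) (E.push 0 n) 1 (E.n - (n + 1))
        { s with tab := tab } (fun κ hκ hn => h2 κ (by omega) hn)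
      refine ⟨tab', fun g => ?_, fun κ hκ hn => h4 κ (by omega) hn⟩
      rw [List.range_succ, WP.forList_append, h1]
      exact h3 g
  obtain ⟨tab, h1, h2⟩ := key E.n
  exact ⟨tab, h1, fun κ hκ => h2 κ (by omega) hκ⟩

end Table

end Semantics

/-! ### Partition of the atoms, and sampling the pairs of one element -/

section Pairs

variable {L : FirstOrder.Language.{u, v}}

/-! ### The atoms that are output for every element and every pair -/

/-- The atoms in which only `a` occurs. Nullary atoms belong to the element `0`. -/
def cellSet (L : FirstOrder.Language.{u, v}) (a : ℕ) : Set (GroundAtom L ℕ) :=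
  {α | (∀ i, α.2 i = a) ∧ (α.1.1 = 0 → a = 0)}

/-- The atoms in which `b` and `a` occur, and nothing else. -/
def pairSet (L : FirstOrder.Language.{u, v}) (b a : ℕ) : Set (GroundAtom L ℕ) :=
  {α | (∀ i, α.2 i = b ∨ α.2 i = a) ∧ (∃ i, α.2 i = b) ∧ ∃ i, α.2 i = a}

/-- The atoms that are output for an element from `{a, …, n - 1}`, or for a pair with a larger
element from this set. -/
def future (L : FirstOrder.Language.{u, v}) (n a : ℕ) : Set (GroundAtom L ℕ) :=
  {α | ∃ a', a ≤ a' ∧ a' < n ∧ (α ∈ cellSet L a' ∨ ∃ b < a', α ∈ pairSet L b a')}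

/-- The atoms over `{0, …, n - 1}` that are not output for an element from `{a, …, n - 1}`, or for
a pair with a larger element from this set. -/
def settled (L : FirstOrder.Language.{u, v}) (n a : ℕ) : Set (GroundAtom L ℕ) :=
  {α | (∀ i, α.2 i < n) ∧ α ∉ future L n a}

/-- The atoms that have been output before the pair of `b` and `a`. -/
def settledPair (L : FirstOrder.Language.{u, v}) (n a b : ℕ) : Set (GroundAtom L ℕ) :=
  {α | α ∈ settled L n (a + 1) ∧ ∀ b', b ≤ b' → b' < a → α ∉ pairSet L b' a}

theorem cellSet_disjoint {a a' : ℕ} {α : GroundAtom L ℕ} (h : α ∈ cellSet L a)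
    (h' : α ∈ cellSet L a') : a = a' := by
  obtain ⟨⟨k, P⟩, x⟩ := α
  rcases Nat.eq_zero_or_pos k with hk | hk
  · rw [h.2 hk, h'.2 hk]
  · rw [← h.1 ⟨0, hk⟩, ← h'.1 ⟨0, hk⟩]

theorem cellSet_pairSet_disjoint {a b a' : ℕ} {α : GroundAtom L ℕ} (hb : b < a')
    (h : α ∈ cellSet L a) (h' : α ∈ pairSet L b a') : False := by
  obtain ⟨-, ⟨i, hi⟩, ⟨k, hk⟩⟩ := h'
  rw [h.1] at hi hk
  omega

theorem pairSet_disjoint {a b a' b' : ℕ} {α : GroundAtom L ℕ} (hb : b < a) (hb' : b' < a')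
    (h : α ∈ pairSet L b a) (h' : α ∈ pairSet L b' a') : a = a' ∧ b = b' := by
  obtain ⟨h, ⟨i, hi⟩, ⟨k, hk⟩⟩ := h
  obtain ⟨h', ⟨i', hi'⟩, ⟨k', hk'⟩⟩ := h'
  have := h i'
  have := h k'
  have := h' i
  have := h' k
  omega

/-- Together with `settledPair_succ` and `settledPair_of_le` this follows the set of final atoms
through one round: first the cell of `a` is added, then its pairs one by one, until `settled L n (a
+ 1)` is reached. -/
theorem settledPair_zero {n a : ℕ} (ha : a < n) :
    settledPair L n a 0 = settled L n a ∪ cellSet L a := by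
  ext α
  constructor
  · rintro ⟨⟨h1, h2⟩, h3⟩
    by_cases hc : α ∈ cellSet L a
    · exact .inr hc
    · refine .inl ⟨h1, ?_⟩
      rintro ⟨a', haa', ha', h⟩
      rcases haa'.eq_or_lt with rfl | hlt
      · exact h.elim hc fun ⟨b, hb, h⟩ => h3 b (Nat.zero_le _) hb h
      · exact h2 ⟨a', hlt, ha', h⟩
  · rintro (⟨h1, h2⟩ | hc)
    · exact ⟨⟨h1, fun ⟨a', haa', h⟩ => h2 ⟨a', by omega, h⟩⟩,
        fun b _ hb h => h2 ⟨a, le_rfl, ha, .inr ⟨b, hb, h⟩⟩⟩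
    · refine ⟨⟨fun i => by rw [hc.1]; exact ha, ?_⟩,
        fun b _ hb h => cellSet_pairSet_disjoint hb hc h⟩
      rintro ⟨a', haa', ha', h | ⟨b, hb, h⟩⟩
      · have := cellSet_disjoint hc h
        omega
      · exact cellSet_pairSet_disjoint hb hc h

theorem settled_disjoint {n a : ℕ} (ha : a < n) {α : GroundAtom L ℕ} (h : α ∈ settled L n a) :
    α ∉ cellSet L a :=
  fun h' => h.2 ⟨a, le_rfl, ha, .inl h'⟩

theorem settledPair_succ {n a b : ℕ} (ha : a < n) (hb : b < a) :
    settledPair L n a (b + 1) = settledPair L n a b ∪ pairSet L b a := by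
  ext α
  constructor
  · rintro ⟨h1, h2⟩
    by_cases hc : α ∈ pairSet L b a
    · exact .inr hc
    · refine .inl ⟨h1, fun b' hb' hlt => ?_⟩
      rcases hb'.eq_or_lt with rfl | h
      · exact hc
      · exact h2 b' h hlt
  · rintro (⟨h1, h2⟩ | hc)
    · exact ⟨h1, fun b' hb' => h2 b' (by omega)⟩
    · refine ⟨⟨fun i => by have := hc.1 i; omega, ?_⟩, fun b' hb' hlt h => ?_⟩
      · rintro ⟨a', haa', ha', h | ⟨b', hb', h⟩⟩
        · exact cellSet_pairSet_disjoint hb h hc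
        · have := pairSet_disjoint hb hb' hc h
          omega
      · have := pairSet_disjoint hb hlt hc h
        omega

theorem settledPair_disjoint {n a b : ℕ} (hb : b < a) {α : GroundAtom L ℕ}
    (h : α ∈ settledPair L n a b) : α ∉ pairSet L b a :=
  h.2 b le_rfl hb

theorem settledPair_of_le {n a b : ℕ} (hb : a ≤ b) :
    settledPair L n a b = settled L n (a + 1) := by
  ext α
  exact ⟨fun h => h.1, fun h => ⟨h, fun b' _ _ => by omega⟩⟩

theorem agree_write {m y : World L ℕ} {Y Z : Set (GroundAtom L ℕ)} (h : ∀ α ∈ Y, α ∉ Z)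
    {s : Mem L} : Agree m (Y ∪ Z) (s.write Z y) ↔ Agree m Y s ∧ ∀ α ∈ Z, y α = m α := by
  constructor
  · intro H
    refine ⟨fun α hα => ?_, fun α hα => ?_⟩
    · simpa [Mem.write, h α hα] using H α (.inl hα)
    · simpa [Mem.write, hα] using H α (.inr hα)
  · rintro ⟨H, H'⟩ α (hα | hα)
    · simpa [Mem.write, h α hα] using H α hα
    · simpa [Mem.write, hα] using H' α hα

/-! ### Output of cells and pairs -/

/-- The elements `0`, `1` stand for `b`, `a`. -/
def pairMap (b a : ℕ) : Fin 2 → ℕ := ![b, a]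

/-- Atoms over `{b, a}` take their values from `ω`. -/
def pairWorld (a : ℕ) (ω : World L (Fin 2)) : World L ℕ := ω.pull fun x => if x = a then 1 else 0

/-- Atoms over `{a}` take their values from `j`. -/
def cellWorld (j : Cell L) : World L ℕ := j.pull fun _ => 0

theorem fin_two_eq (x : Fin 2) : x = 0 ∨ x = 1 := by
  fin_cases x <;> simp

variable [Fintype (Predicate L)]

theorem putCell_eq (j : Cell L) (E : Env L) (g : Mem L → ℝ≥0∞) (s : Mem L) :
    putCell j E g s = g (s.write (cellSet L (E.var 0)) (cellWorld j)) := by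
  rw [putCell, WP.forList_write (fun P => {α | α.1 = P ∧ α ∈ cellSet L (E.var 0)}) (cellWorld j)]
  · congr 2
    ext α
    simp
  · intro P _ g s
    have hput : s.put ⟨P, fun _ => E.var 0⟩ (j ⟨P, fun _ => 0⟩)
        = s.write {⟨P, fun _ => E.var 0⟩} (cellWorld j) :=
      s.put_eq_write ⟨P, fun _ => E.var 0⟩ (cellWorld j)
    have hmem : (P.1 = 0 → E.var 0 = 0) →
        ({⟨P, fun _ => E.var 0⟩} : Set (GroundAtom L ℕ))
          = {α | α.1 = P ∧ α ∈ cellSet L (E.var 0)} := by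
      intro h
      ext ⟨Q, x⟩
      constructor
      · rintro ⟨⟩
        exact ⟨rfl, fun _ => rfl, h⟩
      · rintro ⟨rfl, h, -⟩
        obtain rfl : x = fun _ => E.var 0 := funext h
        rfl
    by_cases hP : P.1 = 0
    · rw [if_pos hP]
      split_ifs with h0
      · rw [hput, hmem fun _ => by omega]
      · have : {α : GroundAtom L ℕ | α.1 = P ∧ α ∈ cellSet L (E.var 0)} = ∅ := by
          ext α
          simp only [Set.mem_ofPred_eq, Set.mem_empty_iff_false, iff_false]
          rintro ⟨rfl, -, h⟩
          have := h hP
          omega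
        rw [this, Mem.write_empty]
    · rw [if_neg hP, hput, hmem fun h => absurd h hP]

theorem putPair_eq (ω : World L (Fin 2)) (E : Env L) (h : E.var 1 < E.var 0)
    (g : Mem L → ℝ≥0∞) (s : Mem L) :
    putPair ω E g s = g (s.write (pairSet L (E.var 1) (E.var 0)) (pairWorld (E.var 0) ω)) := by
  classical
  let f : GroundAtom L (Fin 2) → GroundAtom L ℕ :=
    fun α => ⟨α.1, fun i => E.var (if α.2 i = 1 then 0 else 1)⟩
  rw [putPair, WP.forList_write (fun α => {β | IsMixed α ∧ β = f α}) (pairWorld (E.var 0) ω)]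
  · congr 2
    ext ⟨P, x⟩
    simp only [Finset.mem_toList, Finset.mem_univ, Set.iUnion_true, Set.mem_iUnion,
      Set.mem_ofPred_eq]
    constructor
    · rintro ⟨⟨P, σ⟩, ⟨⟨i, hi⟩, k, hk⟩, ⟨⟩⟩
      refine ⟨fun i => ?_, ⟨i, ?_⟩, k, ?_⟩
      · dsimp only
        split_ifs <;> simp
      · simp only at hi
        simp [hi]
      · simp only at hk
        simp [hk]
    · rintro ⟨h1, ⟨i, hi⟩, k, hk⟩
      simp only at h1 hi hk
      refine ⟨⟨P, fun i => if x i = E.var 0 then 1 else 0⟩, ⟨⟨i, ?_⟩, k, ?_⟩, ?_⟩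
      · have : x i ≠ E.var 0 := by omega
        simp [this]
      · simp [hk]
      · simp only [f]
        congr 1
        funext i
        rcases h1 i with h1 | h1
        · have : x i ≠ E.var 0 := by omega
          simp [h1, h.ne]
        · simp [h1]
  · intro α _ g s
    by_cases hα : IsMixed α
    · have hval : ω α = pairWorld (E.var 0) ω (f α) := by
        obtain ⟨P, σ⟩ := α
        simp only [pairWorld, World.pull, f]
        congr 2
        funext i
        rcases fin_two_eq (σ i) with hi | hi <;> simp [hi, h.ne]
      rw [if_pos hα, hval, Mem.put_eq_write]
      congr 2
      ext β
      simp [hα]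
      rfl
    · rw [if_neg hα]
      simp [hα, Mem.write_empty]

omit [Fintype (Predicate L)] in
theorem pairWorld_pull {b a : ℕ} (m : World L ℕ) {α : GroundAtom L ℕ}
    (hα : α ∈ pairSet L b a) : pairWorld a (m.pull (pairMap b a)) α = m α := by
  obtain ⟨P, x⟩ := α
  simp only [pairWorld, World.pull]
  congr 2
  funext i
  by_cases h : x i = a
  · simp [h, pairMap]
  · simpa [h, pairMap] using ((hα.1 i).resolve_right h).symm

-- A two-element world is determined by its two cells and its mixed atoms: an atom that is not mixed
-- has constant arguments. A nullary atom can be read off from either cell.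
omit [Fintype (Predicate L)] in
theorem eq_pull_pairMap {b a : ℕ} (hb : b < a) {m : World L ℕ} {ω : World L (Fin 2)}
    (h0 : ω.pull (fun _ : Fin 1 => 0) = m.pull fun _ => b)
    (h1 : ω.pull (fun _ : Fin 1 => 1) = m.pull fun _ => a)
    (h : ∀ α ∈ pairSet L b a, pairWorld a ω α = m α) : ω = m.pull (pairMap b a) := by
  funext ⟨P, σ⟩
  by_cases hσ : IsMixed (L := L) ⟨P, σ⟩
  · have := h ⟨P, fun i => pairMap b a (σ i)⟩ ⟨fun i => ?_, ?_, ?_⟩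
    · rw [World.pull, ← this, pairWorld, World.pull]
      congr 2
      funext i
      rcases fin_two_eq (σ i) with hi | hi <;> simp [hi, pairMap, hb.ne]
    · rcases fin_two_eq (σ i) with hi | hi <;> simp [hi, pairMap]
    · obtain ⟨⟨i, hi⟩, -⟩ := hσ
      exact ⟨i, by simp only at hi; simp [hi, pairMap]⟩
    · obtain ⟨-, ⟨i, hi⟩⟩ := hσ
      exact ⟨i, by simp only at hi; simp [hi, pairMap]⟩
  · by_cases h' : ∃ i, σ i = 0
    · obtain rfl : σ = fun _ => 0 := funext fun i =>
        (fin_two_eq (σ i)).resolve_right fun hi => hσ ⟨h', i, hi⟩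
      simpa [World.pull, pairMap] using congrFun h0 ⟨P, fun _ => 0⟩
    · obtain rfl : σ = fun _ => 1 := funext fun i =>
        (fin_two_eq (σ i)).resolve_left fun hi => h' ⟨i, hi⟩
      simpa [World.pull, pairMap] using congrFun h1 ⟨P, fun _ => 0⟩

/-! ### Sampling the pairs of one element -/

variable [L.IsRelational] {Γ : L.Sentence}

-- Each pair multiplies the normalizing constant by `linkWeight` and the remaining weight by the
-- `pairWeight` that `m` prescribes. The recorded cells are needed only where the output agrees with
-- `m`, and there they are the cells of `m`.
open Classical in
theorem pairCmd_loop (E : Env L) {n a : ℕ} (hE : E.var 0 = a) (ha : a < n)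
    (m : World L ℕ) (j : Cell L) (κ : Cell L → ℕ) (tab : ℕ → ℝ≥0) (cell : ℕ → Cell L)
    (X D : ℝ≥0) (g : Mem L → ℝ≥0∞)
    (hg : ∀ s : Mem L, s.count = κ → s.tab = tab → s.cell = cell →
      (Agree m (settled L n (a + 1)) s →
        (j = m.pull fun _ => a) ∧ ∀ b < a, cell b = m.pull fun _ => b) →
      X * g s = if Agree m (settled L n (a + 1)) s then (D : ℝ≥0∞) else 0)
    (s : Mem L) (h₁ : s.count = κ) (h₂ : s.tab = tab) (h₃ : s.cell = cell)
    (h₄ : Agree m (settledPair L n a 0) s →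
      (j = m.pull fun _ => a) ∧ ∀ b < a, cell b = m.pull fun _ => b) :
    ((X * ∏ b ∈ Finset.range a, linkWeight Γ E.W (cell b) j : ℝ≥0) : ℝ≥0∞)
        * WP.forList (List.range n) (fun b => pairCmd Γ j (E.push 1 b)) g s
      = if Agree m (settledPair L n a 0) s then
          ((D * ∏ b ∈ Finset.range a, pairWeight Γ E.W (m.pull fun _ => b) (m.pull fun _ => a)
            (m.pull (pairMap b a)) : ℝ≥0) : ℝ≥0∞)
        else 0 := by
  have key := WP.forList_range_induction (n := n) (c := fun b => pairCmd Γ j (E.push 1 b))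
    (g := g) (fun b h => ∀ s : Mem L, s.count = κ → s.tab = tab → s.cell = cell →
      (Agree m (settledPair L n a b) s →
        (j = m.pull fun _ => a) ∧ ∀ b < a, cell b = m.pull fun _ => b) →
      ((X * ∏ b ∈ Finset.Ico b a, linkWeight Γ E.W (cell b) j : ℝ≥0) : ℝ≥0∞) * h s
      = if Agree m (settledPair L n a b) s then
          ((D * ∏ b ∈ Finset.Ico b a, pairWeight Γ E.W (m.pull fun _ => b) (m.pull fun _ => a)
            (m.pull (pairMap b a)) : ℝ≥0) : ℝ≥0∞)
        else 0) ?_ ?_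
  · simpa using key s h₁ h₂ h₃ h₄
  · intro b hb h IH s h₁ h₂ h₃ h₄
    simp only [pairCmd]
    have hv0 : (E.push 1 b).var 0 = a := by rw [E.push_var_of_ne b (by omega), hE]
    simp only [Env.push_var_self, hv0, Env.push_W]
    by_cases hba : b < a
    · rw [if_pos hba]
      have hw : ∀ ω : World L (Fin 2),
          ((X * ∏ b ∈ Finset.Ico (b + 1) a, linkWeight Γ E.W (cell b) j : ℝ≥0) : ℝ≥0∞)
            * putPair ω (E.push 1 b) h s
          = if Agree m (settledPair L n a b) s ∧
              ∀ α ∈ pairSet L b a, pairWorld a ω α = m α then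
              ((D * ∏ b ∈ Finset.Ico (b + 1) a, pairWeight Γ E.W (m.pull fun _ => b)
                (m.pull fun _ => a) (m.pull (pairMap b a)) : ℝ≥0) : ℝ≥0∞) else 0 := by
        intro ω
        have hiff := agree_write (m := m) (y := pairWorld a ω) (s := s)
          (fun α hα => settledPair_disjoint (n := n) hba hα)
        rw [← settledPair_succ ha hba] at hiff
        rw [putPair_eq ω _ (by simpa [hv0] using hba), Env.push_var_self, hv0,
          IH (s.write (pairSet L b a) (pairWorld a ω)) h₁ h₂ h₃ (fun H => h₄ (hiff.1 H).1)]
        simp only [hiff]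
      rw [WP.switch_eq (a := cell b) _ _ (by simp) (fun c => by rw [h₃, eq_comm]),
        Finset.prod_eq_prod_Ico_succ_bot hba, mul_left_comm, ENNReal.coe_mul, mul_assoc,
        mul_left_comm, linkWeight, WP.choose_univ, Finset.mul_sum]
      simp only [mul_left_comm _ ((pairWeight Γ E.W (cell b) j _ : ℝ≥0) : ℝ≥0∞), hw]
      by_cases hag : Agree m (settledPair L n a b) s
      · obtain ⟨rfl, hcell⟩ := h₄ hag
        -- Only the two-element world induced by `m` survives in the sum: any other has the wrong
        -- cells, hence weight zero, or a mixed atom that contradicts `m`.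
        rw [hcell b hba, if_pos hag, Finset.sum_eq_single (m.pull (pairMap b a)),
          if_pos ⟨hag, fun α hα => pairWorld_pull m hα⟩, ← ENNReal.coe_mul,
          Finset.prod_eq_prod_Ico_succ_bot hba, mul_left_comm]
        · intro ω _ hω
          by_cases hmatch : ∀ α ∈ pairSet L b a, pairWorld a ω α = m α
          · rw [pairWeight, if_neg, ENNReal.coe_zero, zero_mul]
            rintro ⟨h0, h1, -⟩
            exact hω (eq_pull_pairMap hba h0 h1 hmatch)
          · rw [if_neg fun h => hmatch h.2, mul_zero]
        · simp
      · simp [hag]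
    -- For `b ≥ a` the command does nothing, and neither the settled atoms nor the products change.
    · have e1 : settledPair L n a (b + 1) = settledPair L n a b := by
        rw [settledPair_of_le (by omega), settledPair_of_le (by omega)]
      have e2 : Finset.Ico (b + 1) a = Finset.Ico b a := by
        rw [Finset.Ico_eq_empty (by omega), Finset.Ico_eq_empty (by omega)]
      rw [e1, e2] at IH
      rw [if_neg hba]
      exact IH s h₁ h₂ h₃ h₄
  · intro s h₁ h₂ h₃ h₄
    rw [settledPair_of_le ha.le] at h₄ ⊢
    rw [Finset.Ico_eq_empty (by omega)]
    simpa using hg s h₁ h₂ h₃ h₄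

end Pairs

/-! ### Sampling the elements one after another -/

section Elements

variable {L : FirstOrder.Language.{u, v}}

variable [Fintype (Predicate L)] [L.IsRelational] {Γ : L.Sentence}

/-! ### Sampling the elements -/

theorem entry_eq {W : Weighting L} {n : ℕ} {tab : ℕ → ℝ≥0}
    (h : ∀ κ, ∑ c, κ c < n → IsRight Γ W n tab κ) (κ : Cell L → ℕ) :
    entry n tab κ = completion Γ W (n - ∑ c, κ c) κ := by
  rw [entry]
  split_ifs with hlt
  · exact h κ hlt
  · rw [show n - ∑ c, κ c = 0 by omega, completion]

/-- Both cells of a two-element world contain the same nullary atoms, so no such world joins cells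
that differ on one. -/
theorem linkWeight_eq_zero {W : Weighting L} {c j : Cell L} {P : Predicate L} (hP : P.1 = 0)
    (h : c ⟨P, fun _ => 0⟩ ≠ j ⟨P, fun _ => 0⟩) : linkWeight Γ W c j = 0 := by
  refine Finset.sum_eq_zero fun ω _ => ?_
  rw [pairWeight, if_neg]
  rintro ⟨rfl, rfl, -⟩
  refine h ?_
  simp only [World.pull]
  congr 2
  funext i
  exact (Fin.cast hP i).elim0

-- Group the earlier elements by cell. A cell occurs at most `a ≤ n` times, so the cap at `n` is
-- inactive.
omit [L.IsRelational] in
open Classical in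
theorem prod_pow_count (f : Cell L → ℝ≥0) {n a : ℕ} (ha : a ≤ n) (cell : ℕ → Cell L)
    {κ : Cell L → ℕ} (hκ : ∀ c, κ c = ((Finset.range a).filter fun b => cell b = c).card) :
    ∏ c, f c ^ min (κ c) n = ∏ b ∈ Finset.range a, f (cell b) := by
  rw [← Finset.prod_fiberwise' (Finset.range a) cell f]
  refine Finset.prod_congr rfl fun c _ => ?_
  rw [Finset.prod_const, hκ, min_eq_left]
  exact (Finset.card_filter_le _ _).trans (by simpa using ha)

omit [L.IsRelational] in
open Classical in
theorem sum_count {a : ℕ} {cell : ℕ → Cell L} {κ : Cell L → ℕ}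
    (hκ : ∀ c, κ c = ((Finset.range a).filter fun b => cell b = c).card) : ∑ c, κ c = a := by
  simp only [hκ]
  rw [← Finset.card_eq_sum_card_fiberwise (f := cell) (t := Finset.univ) (fun _ _ => by simp)]
  simp

/-- The weight that the element `a` contributes to `m`. -/
def elemWeight (Γ : L.Sentence) (W : Weighting L) (m : World L ℕ) (a : ℕ) : ℝ≥0 :=
  firstWeight Γ W a (m.pull fun _ => a) * ∏ b ∈ Finset.range a,
    pairWeight Γ W (m.pull fun _ => b) (m.pull fun _ => a) (m.pull (pairMap b a))

/-- The total weight of the ways to add the elements `a, …, n - 1`. -/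
def total (Γ : L.Sentence) (W : Weighting L) (n : ℕ) (tab : ℕ → ℝ≥0) (κ : Cell L → ℕ)
    (a : ℕ) : ℝ≥0 :=
  if a < n then ∑ j, firstWeight Γ W a j * stepWeight Γ W n tab κ j else 1

/-- From the element `1` on, `firstWeight` has no nullary factor, so the normalizing constant of the
next element is the table entry that the current one was weighted with. This is the cancellation
between consecutive elements. -/
theorem total_succ {W : Weighting L} {n a : ℕ} {tab : ℕ → ℝ≥0}
    (h : ∀ κ, ∑ c, κ c < n → IsRight Γ W n tab κ) {κ : Cell L → ℕ} (hκ : ∑ c, κ c = a + 1) :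
    total Γ W n tab κ (a + 1) = entry n tab κ := by
  rw [total, entry_eq h]
  split_ifs with hlt
  · rw [← stepWeight_eq (by omega) fun κ' _ => h κ']
    simp [firstWeight]
  · rw [show n - ∑ c, κ c = 0 by omega, completion]

-- The factor `stepWeight` supplies both constants needed after the choice of `j`: the product of
-- the link weights for the pairs and the table entry for the next element. The counters match the
-- recorded cells throughout.
open Classical in
theorem branchCmd_spec (E : Env L) {a : ℕ} (hE : E.var 0 = a) (ha : a < E.n) (m : World L ℕ)
    {tab : ℕ → ℝ≥0} (htab : ∀ κ, ∑ c, κ c < E.n → IsRight Γ E.W E.n tab κ) (D : ℝ≥0)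
    (g : Mem L → ℝ≥0∞)
    (hg : ∀ s : Mem L, s.tab = tab →
      (∀ c, s.count c = ((Finset.range (a + 1)).filter fun b => s.cell b = c).card) →
      (Agree m (settled L E.n (a + 1)) s → ∀ b < a + 1, s.cell b = m.pull fun _ => b) →
      total Γ E.W E.n tab s.count (a + 1) * g s
        = if Agree m (settled L E.n (a + 1)) s then (D : ℝ≥0∞) else 0)
    (s : Mem L) (hs : s.tab = tab)
    (hc : ∀ c, s.count c = ((Finset.range a).filter fun b => s.cell b = c).card)
    (hcell : Agree m (settled L E.n a) s → ∀ b < a, s.cell b = m.pull fun _ => b) (j : Cell L) :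
    stepWeight Γ E.W E.n tab s.count j * branchCmd Γ j E g s
      = if Agree m (settled L E.n a) s ∧ j = m.pull fun _ => a then
          ((D * ∏ b ∈ Finset.range a, pairWeight Γ E.W (m.pull fun _ => b) (m.pull fun _ => a)
            (m.pull (pairMap b a)) : ℝ≥0) : ℝ≥0∞)
        else 0 := by
  have hmatch : j = (m.pull fun _ => a) → ∀ α ∈ cellSet L a, cellWorld j α = m α := by
    rintro rfl ⟨P, x⟩ hα
    obtain rfl : x = fun _ => a := funext hα.1
    rfl
  rw [stepWeight, prod_pow_count (fun c => linkWeight Γ E.W c j) ha.le s.cell hc]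
  -- For `a ≠ 0` the nullary part of `j` is not output, so a conflict with `m` there would not show
  -- in the output and is treated separately.
  by_cases hnull : ∀ P : Predicate L, P.1 = 0 → Agree m (settled L E.n a) s → a ≠ 0 →
      j ⟨P, fun _ => 0⟩ = m ⟨P, fun _ => a⟩
  · have hj : Agree m (settled L E.n a) s → (∀ α ∈ cellSet L a, cellWorld j α = m α) →
        j = m.pull fun _ => a := by
      intro hag h
      funext ⟨P, x⟩
      obtain rfl : x = fun _ => 0 := Subsingleton.elim _ _
      by_cases hP : P.1 = 0 ∧ a ≠ 0
      · exact hnull P hP.1 hag hP.2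
      · exact h ⟨P, fun _ => a⟩ ⟨fun _ => rfl, fun h => by tauto⟩
    have hiff : ∀ s' : Mem L, s'.out = (s.write (cellSet L a) (cellWorld j)).out →
        (Agree m (settledPair L E.n a 0) s' ↔
          Agree m (settled L E.n a) s ∧ j = m.pull fun _ => a) := by
      intro s' hs'
      have : Agree m (settledPair L E.n a 0) s' ↔
          Agree m (settledPair L E.n a 0) (s.write (cellSet L a) (cellWorld j)) := by
        simp only [Agree, hs']
      rw [this, settledPair_zero ha, agree_write fun α hα => settled_disjoint ha hα]
      exact ⟨fun h => ⟨h.1, hj h.1 h.2⟩, fun h => ⟨h.1, hmatch h.2⟩⟩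
    simp only [branchCmd, putCell_eq, hE]
    set s' : Mem L := ((s.write (cellSet L a) (cellWorld j)).setCell a j).setCount j
      ((s.write (cellSet L a) (cellWorld j)).count j + 1) with hs'
    have hcell' : ∀ b < a, s'.cell b = s.cell b := fun b hb => by
      simp [hs', Mem.setCount, Mem.setCell, Mem.write, hb.ne]
    have hcella : s'.cell a = j := by simp [hs', Mem.setCount, Mem.setCell]
    have hcount : s'.count = incr s.count j := by
      funext c
      simp only [hs', Mem.setCount, Mem.setCell, Mem.write, incr]
      by_cases h : c = j <;> simp [h]
    have hcount' : ∀ c, s'.count c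
        = ((Finset.range (a + 1)).filter fun b => s'.cell b = c).card := by
      intro c
      rw [hcount, incr, hc, Finset.range_add_one, Finset.filter_insert, hcella]
      have : (Finset.range a).filter (fun b => s'.cell b = c)
          = (Finset.range a).filter (fun b => s.cell b = c) :=
        Finset.filter_congr fun b hb => by rw [hcell' b (Finset.mem_range.1 hb)]
      rw [this]
      by_cases h : j = c
      · rw [if_pos h.symm, if_pos h, Finset.card_insert_of_notMem (by simp)]
      · rw [if_neg (Ne.symm h), if_neg h, add_zero]
    have := pairCmd_loop (Γ := Γ) E hE ha m j s'.count tab s'.cell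
      (entry E.n tab (incr s.count j)) D g ?_ s' rfl hs rfl ?_
    · rw [Finset.prod_congr rfl fun b hb => by rw [hcell' b (Finset.mem_range.1 hb)],
        mul_comm (entry _ _ _)] at this
      rw [this]
      simp only [hiff s' rfl]
    · intro s'' h1 h2 h3 h4
      rw [← hcount, ← total_succ htab (sum_count hcount'), ← h1]
      refine hg s'' h2 (by rw [h1, h3]; exact hcount') fun H b hb => ?_
      rw [h3]
      rcases Nat.lt_succ_iff_lt_or_eq.1 hb with hb | rfl
      · exact (h4 H).2 b hb
      · rw [hcella]
        exact (h4 H).1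
    · intro H
      obtain ⟨h1, h2⟩ := (hiff s' rfl).1 H
      exact ⟨h2, fun b hb => (hcell' b hb).trans (hcell h1 b hb)⟩
  -- In such a conflict `j` cannot be linked to the element `0`, whose cell is that of `m`; hence
  -- `stepWeight` vanishes.
  · push Not at hnull
    obtain ⟨P, hP, hag, ha0, hne⟩ := hnull
    have h0 : linkWeight Γ E.W (s.cell 0) j = 0 := by
      refine linkWeight_eq_zero hP fun h => hne ?_
      rw [← h, hcell hag 0 (by omega), World.pull]
      congr 2
      funext i
      exact (Fin.cast hP i).elim0
    rw [Finset.prod_eq_zero (Finset.mem_range.2 (Nat.pos_of_ne_zero ha0)) h0, if_neg]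
    · simp
    · rintro ⟨-, rfl⟩
      exact hne rfl

-- Backward induction over the elements. The normalizing constant in front is the total weight for
-- the current counters, and the sum over the possible cells collapses to the cell that `m`
-- prescribes.
open Classical in
theorem elemCmd_loop (E : Env L) (m : World L ℕ) {tab : ℕ → ℝ≥0}
    (htab : ∀ κ, ∑ c, κ c < E.n → IsRight Γ E.W E.n tab κ) (s : Mem L) (hs : s.tab = tab)
    (hc : s.count = fun _ => 0) :
    total Γ E.W E.n tab (fun _ => 0) 0
        * WP.forList (List.range E.n) (fun a => elemCmd Γ (E.push 0 a))
          (fun s => if Agree m (settled L E.n E.n) s then 1 else 0) s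
      = if Agree m (settled L E.n 0) s then
          ((∏ a ∈ Finset.range E.n, elemWeight Γ E.W m a : ℝ≥0) : ℝ≥0∞) else 0 := by
  have key := WP.forList_range_induction (n := E.n) (c := fun a => elemCmd Γ (E.push 0 a))
    (g := fun s => if Agree m (settled L E.n E.n) s then 1 else 0)
    (fun a g => ∀ s : Mem L, s.tab = tab →
      (∀ c, s.count c = ((Finset.range a).filter fun b => s.cell b = c).card) →
      (Agree m (settled L E.n a) s → ∀ b < a, s.cell b = m.pull fun _ => b) →
      total Γ E.W E.n tab s.count a * g s = if Agree m (settled L E.n a) s then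
        ((∏ a ∈ Finset.Ico a E.n, elemWeight Γ E.W m a : ℝ≥0) : ℝ≥0∞) else 0) ?_ ?_
  · simpa [hc] using key s hs (by simp [hc]) (by simp)
  · intro a ha g hg s hs hc hcell
    have hb := branchCmd_spec (E.push 0 a) (by simp) ha m htab _ g hg s hs hc hcell
    simp only [Env.push_W, Env.push_n] at hb
    rw [total, if_pos ha]
    simp only [elemCmd, Env.push_var_self, Env.push_W, Env.push_n, hs]
    rw [WP.choose_univ]
    simp only [ENNReal.coe_mul, mul_assoc]
    simp only [hb]
    by_cases hag : Agree m (settled L E.n a) s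
    · simp only [hag, true_and, if_true, mul_ite, mul_zero]
      rw [Finset.sum_ite_eq' Finset.univ, if_pos (Finset.mem_univ _), ← ENNReal.coe_mul,
        Finset.prod_eq_prod_Ico_succ_bot ha, elemWeight]
      congr 1
      ring
    · simp [hag]
  · intro s _ _ _
    simp [total]

end Elements

/-! ### Factorization of the weight, and correctness of the sampler -/

section Correctness

variable {L : FirstOrder.Language.{u, v}}

/-! ### Models of universal sentences with two variables -/

section Models

variable [L.IsRelational] {ψ : L.BoundedFormula Empty 2}

/-- `ψ(x, y)` holds in `μ`. -/
def World.Holds {M : Type} (μ : World L M) (ψ : L.BoundedFormula Empty 2) (x y : M) : Prop :=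
  @FirstOrder.Language.BoundedFormula.Realize L M μ.toStructure Empty 2 ψ default
    (Fin.snoc (Fin.snoc default x) y)

theorem World.models_iff {M : Type} (μ : World L M) :
    μ.Models ψ.all.all ↔ ∀ x y, μ.Holds ψ x y :=
  Iff.rfl

/-- Embeddings preserve and reflect quantifier-free formulas. Injectivity is what equality atoms
require. -/
theorem World.holds_pull {M M' : Type} {f : M' → M} (hf : Function.Injective f) (μ : World L M)
    (hψ : ψ.IsQF) (x y : M') : (μ.pull f).Holds ψ x y ↔ μ.Holds ψ (f x) (f y) := by
  let _ := μ.toStructure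
  let _ := (μ.pull f).toStructure
  let F : L.Embedding M' M := ⟨⟨f, hf⟩, fun f _ => isEmptyElim f, fun _ _ => Iff.rfl⟩
  have := hψ.realize_embedding F (v := default) (xs := Fin.snoc (Fin.snoc default x) y)
  rw [Fin.comp_snoc, Fin.comp_snoc] at this
  refine Iff.trans this.symm ?_
  rw [World.Holds]
  convert Iff.rfl
  all_goals rfl

/-- An instance `ψ(x, y)` mentions at most two elements, so it can be checked in the substructure
that they induce. One pair `b < a` covers both orders of the arguments. -/
theorem World.models_pull_iff {n : ℕ} (m : World L ℕ) (hψ : ψ.IsQF) :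
    (m.pull (fun i : Fin n => (i : ℕ))).Models ψ.all.all ↔
      ∀ a < n, (m.pull fun _ : Fin 1 => a).Models ψ.all.all ∧
        ∀ b < a, (m.pull (pairMap b a)).Models ψ.all.all := by
  have h1 : ∀ a : ℕ, (m.pull fun _ : Fin 1 => a).Models ψ.all.all ↔ m.Holds ψ a a := by
    intro a
    simp only [models_iff, holds_pull (Function.injective_of_subsingleton _) m hψ, forall_const]
  have h2 : ∀ b a : ℕ, b < a → ((m.pull (pairMap b a)).Models ψ.all.all ↔
      (m.Holds ψ b b ∧ m.Holds ψ b a) ∧ m.Holds ψ a b ∧ m.Holds ψ a a) := by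
    intro b a hb
    have hinj : Function.Injective (pairMap b a) := by
      intro x y h
      rcases fin_two_eq x with rfl | rfl <;> rcases fin_two_eq y with rfl | rfl <;>
        simp [pairMap] at h ⊢ <;> omega
    simp only [models_iff, holds_pull hinj m hψ, Fin.forall_fin_two]
    rfl
  simp only [models_iff (m.pull (fun i : Fin n => (i : ℕ))), holds_pull Fin.val_injective m hψ, h1]
  constructor
  · intro h a ha
    refine ⟨h ⟨a, ha⟩ ⟨a, ha⟩, fun b hb => (h2 b a hb).2 ?_⟩
    have hb' : b < n := by omega
    exact ⟨⟨h ⟨b, hb'⟩ ⟨b, hb'⟩, h ⟨b, hb'⟩ ⟨a, ha⟩⟩, h ⟨a, ha⟩ ⟨b, hb'⟩, h ⟨a, ha⟩ ⟨a, ha⟩⟩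
  · rintro h ⟨x, hx⟩ ⟨y, hy⟩
    rcases lt_trichotomy x y with hlt | rfl | hlt
    · exact ((h2 x y hlt).1 ((h y hy).2 x hlt)).1.2
    · exact (h x hx).1
    · exact ((h2 y x hlt).1 ((h x hx).2 y hlt)).2.1

end Models

/-! ### The weight of a world as a product over elements and pairs -/

open Classical in
/-- The weight of the literals of `m` whose atom is in `S` and `Y`. -/
def setWeight (W : Weighting L) (m : World L ℕ) (S : Finset (GroundAtom L ℕ))
    (Y : Set (GroundAtom L ℕ)) : ℝ≥0 :=
  ∏ α ∈ S, if α ∈ Y then W.lit α.1 (m α) else 1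

theorem setWeight_union (W : Weighting L) (m : World L ℕ) (S : Finset (GroundAtom L ℕ))
    {Y Z : Set (GroundAtom L ℕ)} (h : ∀ α ∈ Y, α ∉ Z) :
    setWeight W m S (Y ∪ Z) = setWeight W m S Y * setWeight W m S Z := by
  rw [setWeight, setWeight, setWeight, ← Finset.prod_mul_distrib]
  refine Finset.prod_congr rfl fun α _ => ?_
  by_cases hY : α ∈ Y
  · simp [hY, h α hY]
  · by_cases hZ : α ∈ Z <;> simp [hY, hZ]

theorem setWeight_eq_prod {ι : Type*} [Fintype ι] (W : Weighting L) (m : World L ℕ)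
    {S : Finset (GroundAtom L ℕ)} {Y : Set (GroundAtom L ℕ)} (p : ι → Prop) [DecidablePred p]
    (f : ι → GroundAtom L ℕ) (hf : ∀ i j, p i → p j → f i = f j → i = j)
    (hS : ∀ i, p i → f i ∈ S) (hY : ∀ α ∈ S, α ∈ Y ↔ ∃ i, p i ∧ f i = α) :
    setWeight W m S Y = ∏ i, if p i then W.lit (f i).1 (m (f i)) else 1 := by
  classical
  rw [setWeight, ← Finset.prod_filter, ← Finset.prod_filter]
  symm
  refine Finset.prod_bij (fun i _ => f i) ?_ ?_ ?_ fun _ _ => rfl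
  · intro i hi
    have hi := (Finset.mem_filter.1 hi).2
    exact Finset.mem_filter.2 ⟨hS i hi, (hY _ (hS i hi)).2 ⟨i, hi, rfl⟩⟩
  · exact fun i hi j hj => hf i j (Finset.mem_filter.1 hi).2 (Finset.mem_filter.1 hj).2
  · intro α hα
    obtain ⟨hα, hαY⟩ := Finset.mem_filter.1 hα
    obtain ⟨i, hi, rfl⟩ := (hY α hα).1 hαY
    exact ⟨i, by simp [hi], rfl⟩

theorem setWeight_settled_succ (W : Weighting L) (m : World L ℕ) (S : Finset (GroundAtom L ℕ))
    {n a : ℕ} (ha : a < n) :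
    setWeight W m S (settled L n (a + 1)) = setWeight W m S (settled L n a)
      * (setWeight W m S (cellSet L a) * ∏ b ∈ Finset.range a, setWeight W m S (pairSet L b a)) := by
  have key : ∀ c ≤ a, setWeight W m S (settledPair L n a c) = setWeight W m S (settled L n a)
      * (setWeight W m S (cellSet L a)
        * ∏ b ∈ Finset.range c, setWeight W m S (pairSet L b a)) := by
    intro c
    induction c with
    | zero =>
      intro _
      rw [settledPair_zero ha, setWeight_union _ _ _ fun α hα => settled_disjoint ha hα]
      simp
    | succ c ih =>
      intro hc
      rw [settledPair_succ ha hc, setWeight_union _ _ _ fun α hα => settledPair_disjoint hc hα,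
        ih (by omega), Finset.prod_range_succ, mul_assoc, mul_assoc]
  rw [← settledPair_of_le le_rfl, key a le_rfl]

/-- Atoms over `{0, …, n - 1}` are partitioned into those of single elements, those of pairs and the
unconstrained rest `settled L n 0`. -/
theorem setWeight_settled (W : Weighting L) (m : World L ℕ) (S : Finset (GroundAtom L ℕ)) (n : ℕ) :
    setWeight W m S (settled L n n) = setWeight W m S (settled L n 0)
      * ∏ a ∈ Finset.range n, (setWeight W m S (cellSet L a)
        * ∏ b ∈ Finset.range a, setWeight W m S (pairSet L b a)) := by
  have key : ∀ a ≤ n, setWeight W m S (settled L n a) = setWeight W m S (settled L n 0)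
      * ∏ a ∈ Finset.range a, (setWeight W m S (cellSet L a)
        * ∏ b ∈ Finset.range a, setWeight W m S (pairSet L b a)) := by
    intro a
    induction a with
    | zero => simp
    | succ a ih =>
      intro ha
      rw [setWeight_settled_succ _ _ _ ha, ih (by omega), Finset.prod_range_succ, mul_assoc]
  exact key n le_rfl

theorem mem_settled_self {n : ℕ} {α : GroundAtom L ℕ} :
    α ∈ settled L n n ↔ ∀ i, α.2 i < n :=
  ⟨fun h => h.1, fun h => ⟨h, fun ⟨a, ha, ha', _⟩ => by omega⟩⟩

/-- The world over `ℕ` that agrees with `μ` on `{0, …, n - 1}` and has no other true atoms. -/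
def World.extend {n : ℕ} (μ : World L (Fin n)) : World L ℕ := fun α =>
  if h : ∀ i, α.2 i < n then μ ⟨α.1, fun i => ⟨α.2 i, h i⟩⟩ else false

theorem World.pull_extend {n : ℕ} (μ : World L (Fin n)) :
    μ.extend.pull (fun i : Fin n => (i : ℕ)) = μ := by
  funext ⟨P, x⟩
  simp [World.pull, World.extend]

variable [Fintype (Predicate L)]

omit [Fintype (Predicate L)] in
theorem agree_settled_self {n : ℕ} (μ : World L (Fin n)) (s : Mem L) :
    Agree μ.extend (settled L n n) s ↔ s.world n = μ := by
  constructor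
  · intro h
    funext ⟨P, x⟩
    have := h ⟨P, fun i => x i⟩ (mem_settled_self.2 fun i => (x i).isLt)
    rw [Mem.world, World.pull, this]
    exact congrFun μ.pull_extend ⟨P, x⟩
  · rintro rfl ⟨P, x⟩ hα
    rw [mem_settled_self] at hα
    simp only at hα
    simp [World.extend, Mem.world, World.pull, hα]

theorem setWeight_settled_self (W : Weighting L) {n : ℕ} (μ : World L (Fin n))
    {S : Finset (GroundAtom L ℕ)} (hS : ∀ α, α ∈ S ↔ ∀ i, α.2 i < n) :
    setWeight W μ.extend S (settled L n n) = W.weight μ := by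
  rw [setWeight_eq_prod W μ.extend (fun _ : GroundAtom L (Fin n) => True)
    (fun α => ⟨α.1, fun i => α.2 i⟩)]
  · refine Finset.prod_congr rfl fun α _ => ?_
    rw [if_pos trivial, Weighting.lit]
    have : μ.extend ⟨α.1, fun i => α.2 i⟩ = μ α := congrFun μ.pull_extend α
    rw [this]
  · rintro ⟨P, x⟩ ⟨Q, y⟩ _ _ h
    obtain rfl : P = Q := congrArg Sigma.fst h
    simp only [Sigma.mk.injEq, heq_eq_eq, true_and] at h
    congr 1
    funext i
    exact Fin.ext (congrFun h i)
  · exact fun α _ => (hS _).2 fun i => (α.2 i).isLt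
  · intro α hα
    rw [hS] at hα
    refine iff_of_true (mem_settled_self.2 hα) ⟨⟨α.1, fun i => ⟨α.2 i, hα i⟩⟩, trivial, rfl⟩

variable [L.IsRelational] (Γ : L.Sentence) (W : Weighting L) (m : World L ℕ)

open Classical in
theorem firstWeight_eq {n a : ℕ} (ha : a < n) {S : Finset (GroundAtom L ℕ)}
    (hS : ∀ α, α ∈ S ↔ ∀ i, α.2 i < n) :
    firstWeight Γ W a (m.pull fun _ => a)
      = if (m.pull fun _ : Fin 1 => a).Models Γ then setWeight W m S (cellSet L a) else 0 := by
  rw [firstWeight, cellWeight]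
  split_ifs with h0 hm hm
  · rw [nullWeight, ← Finset.prod_mul_distrib, setWeight_eq_prod W m
      (fun _ : Predicate L => True) (fun P => ⟨P, fun _ => a⟩)]
    · refine Finset.prod_congr rfl fun P _ => ?_
      split_ifs <;> simp_all [World.pull]
    · exact fun P Q _ _ h => congrArg Sigma.fst h
    · exact fun P _ => (hS _).2 fun _ => ha
    · rintro ⟨P, x⟩ _
      constructor
      · exact fun h => ⟨P, trivial, by rw [← funext h.1]⟩
      · rintro ⟨Q, -, ⟨⟩⟩
        exact ⟨fun _ => rfl, fun _ => by omega⟩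
  · simp
  · rw [one_mul, setWeight_eq_prod W m
      (fun P : Predicate L => P.1 ≠ 0) (fun P => ⟨P, fun _ => a⟩)]
    · refine Finset.prod_congr rfl fun P _ => ?_
      by_cases hP : P.1 = 0 <;> simp [hP, World.pull]
    · exact fun P Q _ _ h => congrArg Sigma.fst h
    · exact fun P _ => (hS _).2 fun _ => ha
    · rintro ⟨P, x⟩ _
      constructor
      · exact fun h => ⟨P, fun hP => by have := h.2 hP; omega, by rw [← funext h.1]⟩
      · rintro ⟨Q, hQ, ⟨⟩⟩
        exact ⟨fun _ => rfl, fun h => absurd h hQ⟩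
  · simp

open Classical in
theorem pairWeight_eq {n a b : ℕ} (ha : a < n) (hb : b < a) {S : Finset (GroundAtom L ℕ)}
    (hS : ∀ α, α ∈ S ↔ ∀ i, α.2 i < n) :
    pairWeight Γ W (m.pull fun _ => b) (m.pull fun _ => a) (m.pull (pairMap b a))
      = if (m.pull (pairMap b a)).Models Γ then setWeight W m S (pairSet L b a) else 0 := by
  have hmap : ∀ x, pairMap b a x = b ∨ pairMap b a x = a := fun x => by
    rcases fin_two_eq x with rfl | rfl <;> simp [pairMap]
  have hinj : Function.Injective (pairMap b a) := by
    intro x y h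
    rcases fin_two_eq x with rfl | rfl <;> rcases fin_two_eq y with rfl | rfl <;>
      simp [pairMap] at h ⊢ <;> omega
  rw [pairWeight]
  by_cases hm : (m.pull (pairMap b a)).Models Γ
  · rw [if_pos ⟨rfl, rfl, hm⟩, if_pos hm, setWeight_eq_prod W m IsMixed
      (fun α => ⟨α.1, fun i => pairMap b a (α.2 i)⟩)]
    · rfl
    · rintro ⟨P, x⟩ ⟨Q, y⟩ _ _ h
      obtain rfl : P = Q := congrArg Sigma.fst h
      simp only [Sigma.mk.injEq, heq_eq_eq, true_and] at h
      congr 1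
      funext i
      exact hinj (congrFun h i)
    · refine fun α _ => (hS _).2 fun i => ?_
      have := hmap (α.2 i)
      dsimp only
      omega
    · rintro ⟨P, x⟩ _
      constructor
      · rintro ⟨h, ⟨i, hi⟩, k, hk⟩
        simp only at h hi hk
        refine ⟨⟨P, fun i => if x i = a then 1 else 0⟩, ⟨⟨i, ?_⟩, k, ?_⟩, ?_⟩
        · simp [hi, hb.ne]
        · simp [hk]
        · congr 1
          funext i
          rcases h i with h | h <;> simp [h, hb.ne, pairMap]
      · rintro ⟨⟨Q, σ⟩, ⟨⟨i, hi⟩, k, hk⟩, ⟨⟩⟩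
        simp only at hi hk
        exact ⟨fun _ => hmap _, ⟨i, by simp [hi, pairMap]⟩, k, by simp [hk, pairMap]⟩
  · rw [if_neg fun h => hm h.2.2, if_neg hm]

-- If `μ` is a model, all factors are honest literal weights and their product is the weight of `μ`.
-- Otherwise some element or pair violates the sentence and contributes the factor zero.
open Classical in
theorem setWeight_mul_elemWeight {ψ : L.BoundedFormula Empty 2} (hψ : ψ.IsQF) {n : ℕ}
    (μ : World L (Fin n)) {S : Finset (GroundAtom L ℕ)} (hS : ∀ α, α ∈ S ↔ ∀ i, α.2 i < n) :
    setWeight W μ.extend S (settled L n 0)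
        * ∏ a ∈ Finset.range n, elemWeight ψ.all.all W μ.extend a
      = if μ.Models ψ.all.all then W.weight μ else 0 := by
  have hiff := World.models_pull_iff (n := n) μ.extend hψ
  rw [μ.pull_extend] at hiff
  by_cases hμ : μ.Models ψ.all.all
  · rw [if_pos hμ, ← setWeight_settled_self W μ hS, setWeight_settled]
    congr 1
    refine Finset.prod_congr rfl fun a ha => ?_
    obtain ⟨h1, h2⟩ := hiff.1 hμ a (Finset.mem_range.1 ha)
    rw [elemWeight, firstWeight_eq _ _ _ (Finset.mem_range.1 ha) hS, if_pos h1]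
    congr 1
    refine Finset.prod_congr rfl fun b hb => ?_
    rw [pairWeight_eq _ _ _ (Finset.mem_range.1 ha) (Finset.mem_range.1 hb) hS,
      if_pos (h2 b (Finset.mem_range.1 hb))]
  · rw [if_neg hμ]
    rw [hiff] at hμ
    push Not at hμ
    obtain ⟨a, ha, h⟩ := hμ
    refine mul_eq_zero_of_right _ (Finset.prod_eq_zero (Finset.mem_range.2 ha) ?_)
    rw [elemWeight, firstWeight_eq _ _ _ ha hS]
    by_cases h1 : (μ.extend.pull fun _ : Fin 1 => a).Models ψ.all.all
    · obtain ⟨b, hb, h⟩ := h h1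
      refine mul_eq_zero_of_right _ (Finset.prod_eq_zero (Finset.mem_range.2 hb) ?_)
      rw [pairWeight_eq _ _ _ ha hb hS, if_neg h]
    · rw [if_neg h1, zero_mul]

/-! ### Correctness of the sampler -/

-- The constant is the product of `w + w̄` over the unconstrained atoms times the total weight of
-- all choices for the elements.
omit m in
open Classical in
theorem sampler_spec {ψ : L.BoundedFormula Empty 2} (hψ : ψ.IsQF) (E : Env L) :
    ∃ Z : ℝ≥0, ∀ μ : World L (Fin E.n),
      Z * sampler ψ.all.all E (fun s => if s.world E.n = μ then 1 else 0) (Mem.init L)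
        = if μ.Models ψ.all.all then (E.W.weight μ : ℝ≥0∞) else 0 := by
  obtain ⟨l, hl, hmem, hfill⟩ := exists_fillCmd_eq E
  -- This table only serves to name the constant before the outcome of the initial coins is known.
  obtain ⟨tab, -, htab⟩ := exists_tableCmd_eq (Γ := ψ.all.all) E (Mem.init L)
  refine ⟨(l.map fun α => if α ∈ settled L E.n 0 then E.W.pos α.1 + E.W.neg α.1 else 1).prod
    * total ψ.all.all E.W E.n tab (fun _ => 0) 0, fun μ => ?_⟩
  have hind : (fun s : Mem L => if s.world E.n = μ then (1 : ℝ≥0∞) else 0)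
      = fun s => if Agree μ.extend (settled L E.n E.n) s then 1 else 0 := by
    funext s
    simp only [agree_settled_self]
  have hS : ∀ α, α ∈ l.toFinset ↔ ∀ i, α.2 i < E.n := by simpa using hmem
  rw [sampler, hfill, hind, ENNReal.coe_mul,
    forList_flipAtom E.W μ.extend (settled L E.n 0) _
      ((∏ a ∈ Finset.range E.n, elemWeight ψ.all.all E.W μ.extend a : ℝ≥0) : ℝ≥0∞) (fun _ => 0) (fun _ => 0) _
      ?_ hl (Mem.init L) rfl rfl, if_pos, ← ENNReal.coe_mul, ← List.prod_toFinset _ hl]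
  · have := setWeight_mul_elemWeight E.W hψ μ hS
    rw [setWeight] at this
    rw [this]
    split_ifs <;> rfl
  · exact fun α ⟨h, h'⟩ => absurd ((hmem α).2 h.1) h'
  · intro s hs _
    obtain ⟨tab', h1, h2⟩ := exists_tableCmd_eq (Γ := ψ.all.all) E s
    -- The table computed after the coins gives the same total, since right entries are determined
    -- by `completion`.
    have htot : total ψ.all.all E.W E.n tab (fun _ => 0) 0
        = total ψ.all.all E.W E.n tab' (fun _ => 0) 0 := by
      simp only [total, stepWeight, entry_eq htab, entry_eq h2]
    rw [h1, htot]
    exact elemCmd_loop E μ.extend h2 _ rfl hs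

end Correctness

end WFOMS

end

theorem mainTheorem4 (L : FirstOrder.Language.{u, v}) [L.IsRelational]
    [Fintype (WFOMS.Predicate L)] (Γ : L.Sentence) (hΓ : Γ ∈ WFOMS.UFO2 L) :
    WFOMS.SamplingLiftable Γ := by
  obtain ⟨ψ, hψ, rfl⟩ := hΓ
  exact (WFOMS.IsCmd.sampler ψ.all.all).samplingLiftable (WFOMS.sampler_spec hψ)
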